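/- Let $m\ge 2$ and $K\ge 1$ be fixed integers and let $C,c>0$ be constants. Consider a sequence of problems with sample size $n\to\infty$ and dimension $p$ such that eventually $p\ge K$ (for instance $p\to\infty$) and $\log^{2m}(p)=o(n)$; all the objects below may change along the sequence. Let $\mathbf Y=\boldsymbol\mu+\xi\,\boldsymbol\Sigma^{1/2}\mathbf U\in\mathbb R^p$, where $\boldsymbol\mu\in\mathbb R^p$, $\boldsymbol\Sigma$ is a positive semidefinite $p\times p$ matrix with positive semidefinite square root $\boldsymbol\Sigma^{1/2}$, $\mathbf U$ is uniformly distributed on the unit sphere of $\mathbb R^p$, and $\xi\ge 0$ is a random variable independent of $\mathbf U$ with $\mathbb E\xi^2=p$. Put $\theta_m=p^{-m}\,\mathbb E\,\xi^{2m}$. Assume that $\max_{1\le j\le p}\|Y_j-\mu_j\|_{\psi}\le C$, where $\|X\|_{\psi}=\sup_{k\ge 1}k^{-1}(\mathbb E|X|^k)^{1/k}$, the supremum being over integers $k$ (this holds in particular when the coordinates are sub-Gaussian with $\sup_{k\ge 1}k^{-1/2}(\mathbb E|Y_j-\mu_j|^k)^{1/k}\le C$), and that the minimum eigenvalue of $\boldsymbol\Sigma_{JJ}$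 is at least $c$ for every $J\subset\{1,\dots,p\}$ with $|J|=K$. Let $\mathcal A$ be a nonrandom, non-empty collection of pairwise disjoint non-empty blocks $J\subset\{1,\dots,p\}$ with $|J|\le K$. For $1\le k\le p$ let $c^*_{m,k}=p^m\,\mathbb E(B^m)$ with $B\sim\mathrm{Beta}\bigl(\tfrac k2,\tfrac{p-k}2\bigr)$ ($B=1$ if $k=p$). Given i.i.d. copies $\mathbf Y_1,\dots,\mathbf Y_n$ of $\mathbf Y$, let $\widehat{\boldsymbol\mu}=\frac1n\sum_i\mathbf Y_i$ and $\widehat{\boldsymbol\Sigma}=\frac1n\sum_i(\mathbf Y_i-\widehat{\boldsymbol\mu})(\mathbf Y_i-\widehat{\boldsymbol\mu})^{\mathrm T}$, and define the blockwise aggregation estimator with these estimates plugged in, $$\widehat\theta^{\,\mathrm B}_m=\frac1{|\mathcal A|}\sum_{J\in\mathcal A}\frac1{n\,c^*_{m,|J|}}\sum_{i=1}^n\Bigl\{(\mathbf Y_{i,J}-\widehat{\boldsymbol\mu}_J)^{\mathrm T}\,\widehat{\boldsymbol\Sigma}_{JJ}^{-1}\,(\mathbf Y_{i,J}-\widehat{\boldsymbol\mu}_J)\Bigr\}^m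 ,$$ where $\mathbf v_J$ and $\mathbf M_{JJ}$ denote the subvector and the principal submatrix with indices in $J$ (an inverse that does not exist is read as $0$). Then $$|\widehat\theta^{\,\mathrm B}_m-\theta_m|=O_{\mathbb P}(n^{-1/2}),$$ that is, for every $\epsilon>0$ there is $M>0$ such that $\mathbb P\bigl(|\widehat\theta^{\,\mathrm B}_m-\theta_m|>M n^{-1/2}\bigr)\le\epsilon$ eventually along the sequence. -/

import Mathlib

open MeasureTheory ProbabilityTheory Filter
open scoped ENNReal Matrix MatrixOrder

namespace EllipticalMoment

/-- The uniform distribution on the unit sphere of `ℝᵖ`, as a measure on `ℝᵖ` (for `p ≥ 1`):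
the normalized surface measure. -/
noncomputable def uniformSphere (p : ℕ) : Measure (EuclideanSpace ℝ (Fin p)) :=
  (((volume : Measure (EuclideanSpace ℝ (Fin p))).toSphere Set.univ)⁻¹ •
    (volume : Measure (EuclideanSpace ℝ (Fin p))).toSphere).map Subtype.val

/-- The law of `Y = μ + ξ Σ^{1/2} U`, where `ξ` has law `ν`, `U` is uniform on the unit sphere and
`ξ`, `U` are independent. `CFC.sqrt Sig` is the positive semidefinite square root of the
positive semidefinite matrix `Sig`. -/
noncomputable def ellipticalLaw {p : ℕ} (mu : EuclideanSpace ℝ (Fin p))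
    (Sig : Matrix (Fin p) (Fin p) ℝ) (nu : Measure ℝ) : Measure (EuclideanSpace ℝ (Fin p)) :=
  (nu.prod (uniformSphere p)).map
    (fun z => mu + z.1 • WithLp.toLp 2 (CFC.sqrt Sig *ᵥ WithLp.ofLp z.2))

/-- Admissible laws of the radial variable `ξ`: probability laws on `[0, ∞)` with `E ξ² = p`. -/
structure IsRadialLaw (p : ℕ) (nu : Measure ℝ) : Prop where
  isProbabilityMeasure : IsProbabilityMeasure nu
  nonneg : ∀ᵐ r ∂nu, 0 ≤ r
  sq_integrable : Integrable (fun r => r ^ 2) nu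
  second_moment : ∫ r, r ^ 2 ∂nu = (p : ℝ)

/-- The scaled even moment `θ_m = p⁻ᵐ E ξ²ᵐ`. -/
noncomputable def scaledMoment (p m : ℕ) (nu : Measure ℝ) : ℝ :=
  (∫ r, r ^ (2 * m) ∂nu) / (p : ℝ) ^ m

/-- `‖X‖ = sup_{k ≥ 1} k⁻¹ (E |X|ᵏ)^{1/k}`, with values in `[0, ∞]`. -/
noncomputable def psiNorm {Ω : Type*} [MeasurableSpace Ω] (X : Ω → ℝ) (P : Measure Ω) : ℝ≥0∞ :=
  ⨆ (k : ℕ) (_ : 1 ≤ k), eLpNorm X (k : ℝ≥0∞) P / (k : ℝ≥0∞)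

/-- The law of `B ∼ Beta(k/2, (p-k)/2)`, `1 ≤ k ≤ p`; for `k = p` it is the point mass at `1`
(then `B` is the squared norm of a unit vector). -/
noncomputable def betaLaw (p k : ℕ) : Measure ℝ :=
  if k < p then betaMeasure ((k : ℝ) / 2) (((p : ℝ) - k) / 2) else Measure.dirac 1

/-- `c*_{m,k} = pᵐ E Bᵐ` with `B ∼ Beta(k/2, (p-k)/2)`. -/
noncomputable def cStar (p m k : ℕ) : ℝ :=
  (p : ℝ) ^ m * ∫ b, b ^ m ∂(betaLaw p k)

/-- The diagonal block `M_{JJ}`. -/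
def diagBlock {p : ℕ} (M : Matrix (Fin p) (Fin p) ℝ) (J : Finset (Fin p)) : Matrix J J ℝ :=
  M.submatrix Subtype.val Subtype.val

/-- The quadratic form `(v_J)ᵀ (M_{JJ})⁻¹ v_J`. -/
noncomputable def blockForm {p : ℕ} (v : EuclideanSpace ℝ (Fin p))
    (M : Matrix (Fin p) (Fin p) ℝ) (J : Finset (Fin p)) : ℝ :=
  (fun j : J => v j) ⬝ᵥ ((diagBlock M J)⁻¹ *ᵥ fun j : J => v j)

/-- The blockwise estimator of `θ_m` from the coordinates in `J` of the sample `y`, at `(mu, S)`. -/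
noncomputable def blockEstimator {n p : ℕ} (m : ℕ) (J : Finset (Fin p))
    (mu : EuclideanSpace ℝ (Fin p)) (S : Matrix (Fin p) (Fin p) ℝ)
    (y : Fin n → EuclideanSpace ℝ (Fin p)) : ℝ :=
  (∑ i, blockForm (y i - mu) S J ^ m) / ((n : ℝ) * cStar p m J.card)

/-- The blockwise aggregation estimator of `θ_m` over the collection of blocks `A`,
at `(mu, S)`; it depends on `S` through the blocks `S_{JJ}`, `J ∈ A`, only. -/
noncomputable def bae {n p : ℕ} (m : ℕ) (A : Finset (Finset (Fin p)))
    (mu : EuclideanSpace ℝ (Fin p)) (S : Matrix (Fin p) (Fin p) ℝ)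
    (y : Fin n → EuclideanSpace ℝ (Fin p)) : ℝ :=
  (∑ J ∈ A, blockEstimator m J mu S y) / (A.card : ℝ)

/-- The sample mean vector. -/
noncomputable def sampleMean {n p : ℕ} (y : Fin n → EuclideanSpace ℝ (Fin p)) :
    EuclideanSpace ℝ (Fin p) :=
  (n : ℝ)⁻¹ • ∑ i, y i

/-- The sample covariance matrix `n⁻¹ ∑ᵢ (yᵢ - ȳ)(yᵢ - ȳ)ᵀ`. -/
noncomputable def sampleCov {n p : ℕ} (y : Fin n → EuclideanSpace ℝ (Fin p)) :
    Matrix (Fin p) (Fin p) ℝ :=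
  Matrix.of fun j k => (n : ℝ)⁻¹ * ∑ i, (y i j - sampleMean y j) * (y i k - sampleMean y k)

/-- `X_t = O_P(a_t)` as `t → ∞`, where `X_t` lives on its own probability space `(Ω_t, P_t)`. -/
def IsBigOInProb {Ω : ℕ → Type*} [∀ t, MeasurableSpace (Ω t)] (P : ∀ t, Measure (Ω t))
    (X : ∀ t, Ω t → ℝ) (a : ℕ → ℝ) : Prop :=
  ∀ ε : ℝ, 0 < ε → ∃ M : ℝ, 0 < M ∧
    ∀ᶠ t in atTop, P t {ω | M * a t < |X t ω|} ≤ ENNReal.ofReal ε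

end EllipticalMoment

/-! The proof is an `L¹` bound. For every block, the error of its estimator is dominated pointwise
by an integrable variable of mean at most `D n^{-1/2}`, with `D` depending only on `m`, `K`, `c`,
`C` (`exists_blockEstimator_error_majorant`). Linearity of expectation carries this bound to the
average over blocks, whatever their number and dependence, and Markov's inequality finishes.

For one block, let the data be centred at the true mean. With the true covariance block, the
quadratic form equals `ξ²` times the squared length of a projection of `U` onto `|J|` orthonormal
directions (`exists_orthonormal_blockForm`). The moments of that projection are Beta moments
(`integral_orthonormal_block_uniformSphere`), so the oracle average of `m`-th powers has mean
exactly `c* θ_m`, and its variance is `O(1/n)`. Since `c* ≥ 1`, dividing by it is harmless.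

The plug-in error is bounded by a deterministic inequality, `abs_plugIn_sub_le`. Let `R` be the
squared deviation of the first two sample moments and `H` the average of `(1 + |x_i|²)^m`. If `√R`
is below a fixed radius, coercivity survives the perturbation and the error is at most a constant
times `√R · H`. If not, the sample covariance may be nearly singular, but the leverages sum to
`n|J|`, so the average of their `m`-th powers is at most `K^m n^{m-1}` on every sample; this is
charged to `n^{m-1} R^m`.

The `ψ`-norm bounds all even coordinate moments, and a moment inequality for sums of independent
centred variables (`integral_sum_pow_even_le`) gives `E R^r = O(n^{-r})`. Hence `E √R · H =
O(n^{-1/2})` and `E n^{m-1} R^m = O(1/n)`. -/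

namespace EllipticalMoment

/-! ### Polar coordinates with a Gaussian weight -/

section Sphere

open Set Module

variable {E : Type*} [NormedAddCommGroup E] [NormedSpace ℝ E] [MeasurableSpace E] [BorelSpace E]
  [FiniteDimensional ℝ E] [Nontrivial E]

/-- Polar coordinates for a positively homogeneous function with a Gaussian weight. -/
theorem integral_homogeneous_mul_exp_neg_sq_norm (μ : Measure E) [μ.IsAddHaarMeasure]
    {f : E → ℝ} {d : ℕ} (hf : ∀ (r : ℝ) (x : E), 0 < r → f (r • x) = r ^ d * f x) :
    ∫ x, f x * Real.exp (-‖x‖ ^ 2) ∂μ =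
      (∫ u, f u ∂μ.toSphere) *
        ∫ r in Ioi (0 : ℝ), r ^ (finrank ℝ E - 1 + d) * Real.exp (-r ^ 2) := by
  calc
    ∫ x, f x * Real.exp (-‖x‖ ^ 2) ∂μ
        = ∫ x : ({(0)}ᶜ : Set E), f x * Real.exp (-‖(x : E)‖ ^ 2) ∂(μ.comap (↑)) := by
      rw [integral_subtype_comap (measurableSet_singleton _).compl
        fun x : E ↦ f x * Real.exp (-‖x‖ ^ 2), restrict_compl_singleton]
    _ = ∫ z, f z.1 * ((z.2 : ℝ) ^ d * Real.exp (-(z.2 : ℝ) ^ 2))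
          ∂μ.toSphere.prod (.volumeIoiPow (finrank ℝ E - 1)) := by
      rw [← μ.measurePreserving_homeomorphUnitSphereProd.integral_comp
        (Homeomorph.measurableEmbedding _)]
      refine integral_congr_ae (ae_of_all _ fun x => ?_)
      have hx : 0 < ‖(x : E)‖ := norm_pos_iff.2 x.2
      have h := hf ‖(x : E)‖ (‖(x : E)‖⁻¹ • x) hx
      rw [smul_inv_smul₀ hx.ne'] at h
      simp only [homeomorphUnitSphereProd_apply_snd_coe, homeomorphUnitSphereProd_apply_fst_coe]
      rw [h]
      ring
    _ = (∫ u, f u ∂μ.toSphere) * ∫ r : Ioi (0 : ℝ), (r : ℝ) ^ d * Real.exp (-(r : ℝ) ^ 2)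
          ∂(.volumeIoiPow (finrank ℝ E - 1)) :=
      integral_prod_mul (fun u : Metric.sphere (0 : E) 1 => f u)
        (fun r : Ioi (0 : ℝ) => (r : ℝ) ^ d * Real.exp (-(r : ℝ) ^ 2))
    _ = _ := by
      congr 1
      simp only [Measure.volumeIoiPow, ENNReal.ofReal]
      rw [integral_withDensity_eq_integral_smul,
        integral_subtype_comap measurableSet_Ioi fun a : ℝ ↦
          Real.toNNReal (a ^ (finrank ℝ E - 1)) • (a ^ d * Real.exp (-a ^ 2)),
        setIntegral_congr_fun measurableSet_Ioi fun x hx ↦ ?_]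
      · rw [NNReal.smul_def, Real.coe_toNNReal _ (pow_nonneg hx.out.le _), smul_eq_mul, pow_add]
        ring
      · exact (measurable_subtype_coe.pow_const _).real_toNNReal

theorem integral_pow_mul_exp_neg_sq (a : ℕ) :
    ∫ r in Ioi (0 : ℝ), r ^ a * Real.exp (-r ^ 2) = Real.Gamma (((a : ℝ) + 1) / 2) / 2 := by
  have h := integral_rpow_mul_exp_neg_rpow (p := 2) (q := a) (by norm_num)
    (by have : (0 : ℝ) ≤ a := a.cast_nonneg
        linarith)
  simp only [Real.rpow_natCast, Real.rpow_two] at h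
  rw [h]
  ring

theorem integral_pow_finrank_mul_exp_neg_sq {k : ℕ} (hk : 0 < k) (m : ℕ) :
    ∫ r in Ioi (0 : ℝ), r ^ (k - 1 + 2 * m) * Real.exp (-r ^ 2) =
      Real.Gamma ((k : ℝ) / 2 + m) / 2 := by
  rw [integral_pow_mul_exp_neg_sq]
  congr 2
  push_cast [Nat.cast_sub hk]
  ring

theorem integral_sq_norm_pow_mul_exp_neg_sq_norm (μ : Measure E) [μ.IsAddHaarMeasure] (m : ℕ) :
    ∫ x : E, (‖x‖ ^ 2) ^ m * Real.exp (-‖x‖ ^ 2) ∂μ =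
      μ.toSphere.real univ * (Real.Gamma ((finrank ℝ E : ℝ) / 2 + m) / 2) := by
  rw [integral_homogeneous_mul_exp_neg_sq_norm μ (f := fun x => (‖x‖ ^ 2) ^ m) (d := 2 * m),
    integral_pow_finrank_mul_exp_neg_sq finrank_pos]
  · congr 1
    simp
  · intro r x hr
    rw [norm_smul, mul_pow, mul_pow, Real.norm_of_nonneg hr.le, pow_mul]

end Sphere

/-! ### Beta moments and the normalising constant `c*` -/

/-- The product of `x^m` and the `Beta(α, β)` density is a constant multiple of the `Beta(α + m, β)`
density, whose total mass is one. -/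
theorem integral_pow_betaMeasure {α β : ℝ} (hα : 0 < α) (hβ : 0 < β) (m : ℕ) :
    ∫ b, b ^ m ∂(betaMeasure α β) =
      Real.Gamma (α + m) * Real.Gamma (α + β) / (Real.Gamma α * Real.Gamma (α + β + m)) := by
  have hαm : 0 < α + m := by positivity
  have hpdf : ∀ x : ℝ, 0 ≤ betaPDFReal (α + m) β x := fun x => by
    by_cases h : 0 < x ∧ x < 1
    · exact (betaPDFReal_pos h.1 h.2 hαm hβ).le
    · simp [betaPDFReal, h]
  have hone : ∫ x, betaPDFReal (α + m) β x = 1 := by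
    rw [integral_eq_lintegral_of_nonneg_ae (ae_of_all _ hpdf) (by fun_prop)]
    have := lintegral_betaPDF_eq_one hαm hβ
    simp only [betaPDF] at this
    simp [this]
  have hkey : ∀ x : ℝ, (betaPDF α β x).toReal • x ^ m =
      beta (α + m) β / beta α β * betaPDFReal (α + m) β x := fun x => by
    by_cases h : 0 < x ∧ x < 1
    · rw [betaPDF, ENNReal.toReal_ofReal (betaPDFReal_pos h.1 h.2 hα hβ).le]
      simp only [betaPDFReal, if_pos h, smul_eq_mul]
      have h1 := (beta_pos hα hβ).ne'
      have h2 := (beta_pos hαm hβ).ne'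
      have h3 : x ^ (α + m - 1) = x ^ (α - 1) * x ^ m := by
        rw [← Real.rpow_natCast, ← Real.rpow_add h.1]
        congr 1
        ring
      rw [h3]
      field_simp
    · simp [betaPDF, betaPDFReal, h]
  rw [betaMeasure, integral_withDensity_eq_integral_toReal_smul
    (by unfold betaPDF; fun_prop) (ae_of_all _ fun x => by simp [betaPDF])]
  simp_rw [hkey]
  rw [integral_const_mul, hone, beta, beta]
  have := (Real.Gamma_pos_of_pos hα).ne'
  have := (Real.Gamma_pos_of_pos hβ).ne'
  have := (Real.Gamma_pos_of_pos (add_pos hα hβ)).ne'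
  have := (Real.Gamma_pos_of_pos (add_pos hαm hβ)).ne'
  rw [show α + β + m = α + m + β by ring]
  field_simp

/-- The `m`-th moment of `Beta(k/2, (p-k)/2)`. -/
noncomputable def betaMoment (p m k : ℕ) : ℝ :=
  Real.Gamma ((k : ℝ) / 2 + m) * Real.Gamma ((p : ℝ) / 2) /
    (Real.Gamma ((k : ℝ) / 2) * Real.Gamma ((p : ℝ) / 2 + m))

theorem cStar_eq {p k : ℕ} (m : ℕ) (hk : 0 < k) (hkp : k ≤ p) :
    cStar p m k = (p : ℝ) ^ m * betaMoment p m k := by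
  have hk' : (0 : ℝ) < k := by exact_mod_cast hk
  unfold cStar betaLaw betaMoment
  congr 1
  split_ifs with h
  · have h' : (k : ℝ) < p := by exact_mod_cast h
    rw [integral_pow_betaMeasure (by positivity) (by linarith)]
    congr 3 <;> ring_nf
  -- In the degenerate case the point mass at `1` has all moments `1`, and the Gamma quotient also
  -- cancels to `1`.
  · obtain rfl : k = p := by omega
    have := (Real.Gamma_pos_of_pos (half_pos hk')).ne'
    have := (Real.Gamma_pos_of_pos (by positivity : 0 < (k : ℝ) / 2 + m)).ne'
    rw [integral_dirac]
    field_simp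
    simp

theorem betaMoment_succ {p k : ℕ} (m : ℕ) (hk : 0 < k) (hp : 0 < p) :
    betaMoment p (m + 1) k = betaMoment p m k * ((k + 2 * m) / (p + 2 * m)) := by
  have hk' : (0 : ℝ) < k := by exact_mod_cast hk
  have hp' : (0 : ℝ) < p := by exact_mod_cast hp
  unfold betaMoment
  push_cast
  rw [← add_assoc, ← add_assoc, Real.Gamma_add_one (by positivity),
    Real.Gamma_add_one (by positivity)]
  have := (Real.Gamma_pos_of_pos (half_pos hk')).ne'
  have := (Real.Gamma_pos_of_pos (by positivity : 0 < (p : ℝ) / 2 + m)).ne'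
  field_simp

theorem betaMoment_zero {p k : ℕ} (hk : 0 < k) (hp : 0 < p) : betaMoment p 0 k = 1 := by
  have hk' : (0 : ℝ) < k := by exact_mod_cast hk
  have hp' : (0 : ℝ) < p := by exact_mod_cast hp
  have := (Real.Gamma_pos_of_pos (half_pos hk')).ne'
  have := (Real.Gamma_pos_of_pos (half_pos hp')).ne'
  unfold betaMoment
  simp only [Nat.cast_zero, add_zero]
  field_simp

/-- Passing from `m` to `m + 1` multiplies `c*` by `p (k + 2m) / (p + 2m)`, which is at least `1`
because `k, p ≥ 1`. Thus division by `c*` never enlarges a block error. -/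
theorem one_le_cStar {p k : ℕ} (m : ℕ) (hk : 0 < k) (hkp : k ≤ p) : 1 ≤ cStar p m k := by
  rw [cStar_eq m hk hkp]
  have hk' : (1 : ℝ) ≤ k := by exact_mod_cast hk
  have hp' : (1 : ℝ) ≤ p := by exact_mod_cast hk.trans_le hkp
  induction m with
  | zero => simp [betaMoment_zero hk (hk.trans_le hkp)]
  | succ m ih =>
    rw [betaMoment_succ m hk (hk.trans_le hkp), pow_succ]
    have h : 1 ≤ (p : ℝ) * ((k + 2 * m) / (p + 2 * m)) := by
      rw [mul_div_assoc', one_le_div (by positivity)]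
      have : (0 : ℝ) ≤ m := m.cast_nonneg
      nlinarith [mul_nonneg this (sub_nonneg.2 hp'), mul_nonneg (sub_nonneg.2 hk')
        (by linarith : (0 : ℝ) ≤ p)]
    nlinarith

/-! ### Moments of the uniform distribution on the sphere -/

section UniformSphere

open Set Module

local notation "𝔼" p => EuclideanSpace ℝ (Fin p)

theorem euclideanSpace_nontrivial {p : ℕ} (hp : 0 < p) : Nontrivial (𝔼 p) :=
  nontrivial_of_finrank_pos (R := ℝ) (by simp [hp])

theorem toSphere_real_univ_pos {p : ℕ} (hp : 0 < p) :
    0 < (volume : Measure (𝔼 p)).toSphere.real univ := by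
  have := euclideanSpace_nontrivial hp
  rw [measureReal_def, ENNReal.toReal_pos_iff]
  exact ⟨pos_iff_ne_zero.2 (by simp [-Measure.toSphere_apply_univ]), measure_lt_top _ _⟩

theorem integral_uniformSphere {p : ℕ} (f : (𝔼 p) → ℝ) :
    ∫ u, f u ∂(uniformSphere p) = ((volume : Measure (𝔼 p)).toSphere.real univ)⁻¹ *
      ∫ u, f u ∂(volume : Measure (𝔼 p)).toSphere := by
  rw [uniformSphere, (MeasurableEmbedding.subtype_coe
    Metric.isClosed_sphere.measurableSet).integral_map, integral_smul_measure,
    ENNReal.toReal_inv, smul_eq_mul, measureReal_def]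

theorem isProbabilityMeasure_uniformSphere {p : ℕ} (hp : 0 < p) :
    IsProbabilityMeasure (uniformSphere p) := by
  constructor
  rw [uniformSphere, Measure.map_apply measurable_subtype_coe MeasurableSet.univ, preimage_univ,
    Measure.smul_apply, smul_eq_mul, ENNReal.inv_mul_cancel _ (measure_ne_top _ _)]
  intro h
  have := toSphere_real_univ_pos hp
  rw [measureReal_def, h] at this
  simp at this

theorem ae_norm_eq_one_uniformSphere (p : ℕ) : ∀ᵐ u ∂(uniformSphere p), ‖u‖ = 1 := by
  rw [uniformSphere, ae_map_iff measurable_subtype_coe.aemeasurable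
    (measurableSet_eq_fun measurable_norm measurable_const)]
  exact ae_of_all _ fun u => by simp

theorem integrable_uniformSphere {p : ℕ} (hp : 0 < p) {f : (𝔼 p) → ℝ} (hf : Continuous f) :
    Integrable f (uniformSphere p) := by
  have := isProbabilityMeasure_uniformSphere hp
  obtain ⟨B, hB⟩ := (isCompact_sphere (0 : 𝔼 p) 1).exists_bound_of_continuousOn hf.continuousOn
  refine Integrable.of_bound hf.aestronglyMeasurable B ?_
  filter_upwards [ae_norm_eq_one_uniformSphere p] with u hu
  exact hB u (by simpa using hu)

/-- The Gaussian weight factorises over `J` and its complement, so this is Fubini's theorem. -/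
theorem integral_coordinate_block_mul_exp_neg_sq_norm {p : ℕ} (J : Finset (Fin p)) (m : ℕ) :
    ∫ x : 𝔼 p, (∑ j ∈ J, x j ^ 2) ^ m * Real.exp (-‖x‖ ^ 2) =
      (∫ x : EuclideanSpace ℝ J, (‖x‖ ^ 2) ^ m * Real.exp (-‖x‖ ^ 2)) *
        ∫ x : {j // j ∉ J} → ℝ, Real.exp (-∑ j, x j ^ 2) := by
  have h1 := (PiLp.volume_preserving_ofLp (Fin p)).integral_comp
    (MeasurableEquiv.toLp 2 (Fin p → ℝ)).symm.measurableEmbedding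
    (fun x => (∑ j ∈ J, x j ^ 2) ^ m * Real.exp (-∑ j, x j ^ 2))
  have h2 := (PiLp.volume_preserving_ofLp J).integral_comp
    (MeasurableEquiv.toLp 2 (J → ℝ)).symm.measurableEmbedding
    (fun x => (∑ j, x j ^ 2) ^ m * Real.exp (-∑ j, x j ^ 2))
  have h3 := (volume_preserving_piEquivPiSubtypeProd (fun _ : Fin p => ℝ) (· ∈ J)).integral_comp
    (MeasurableEquiv.measurableEmbedding _)
    (fun z => ((∑ j, z.1 j ^ 2) ^ m * Real.exp (-∑ j, z.1 j ^ 2)) *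
      Real.exp (-∑ j, z.2 j ^ 2))
  simp only [EuclideanSpace.real_norm_sq_eq]
  rw [h1, h2]
  rw [Measure.volume_eq_prod, integral_prod_mul
    (fun x : J → ℝ => (∑ j, x j ^ 2) ^ m * Real.exp (-∑ j, x j ^ 2))
    (fun x : {j // j ∉ J} → ℝ => Real.exp (-∑ j, x j ^ 2))] at h3
  rw [Subsingleton.elim (Subtype.fintype fun j => j ∈ J) (Finset.Subtype.fintype J)] at h3
  refine Eq.trans ?_ h3
  refine integral_congr_ae (ae_of_all _ fun x => ?_)
  simp only [MeasurableEquiv.piEquivPiSubtypeProd, MeasurableEquiv.coe_mk,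
    Equiv.piEquivPiSubtypeProd_apply]
  have hs := Fintype.sum_subtype_add_sum_subtype (fun j => j ∈ J) (fun j => x j ^ 2)
  rw [Subsingleton.elim (Subtype.fintype fun j => j ∈ J) (Finset.Subtype.fintype J)] at hs
  rw [mul_assoc, ← Real.exp_add, ← neg_add, hs, Finset.sum_coe_sort J (fun j => x j ^ 2)]

/-- Extend `v` to an orthonormal basis and rotate it to the coordinate basis. The Gaussian integral
of the `m`-th power is then computed twice: in polar coordinates on the whole space, and by Fubini
with polar coordinates on the `J`-factor. The law of the projection itself is never needed. -/
theorem integral_orthonormal_block_uniformSphere {p : ℕ} {J : Finset (Fin p)} (hJ : J.Nonempty)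
    {v : Fin p → 𝔼 p} (hv : Orthonormal ℝ ((J : Set (Fin p)).domRestrict v)) (m : ℕ) :
    ∫ u, (∑ j ∈ J, inner ℝ (v j) u ^ 2) ^ m ∂(uniformSphere p) = betaMoment p m J.card := by
  have hk : 0 < J.card := hJ.card_pos
  have hp : 0 < p := hk.trans_le (by simpa using J.card_le_univ)
  have := euclideanSpace_nontrivial hp
  have hJn : Nonempty J := hJ.to_subtype
  obtain ⟨b, hb⟩ := hv.exists_orthonormalBasis_extension_of_card_eq (by simp)
  have hbv : ∀ u : 𝔼 p, ∑ j ∈ J, inner ℝ (v j) u ^ 2 = ∑ j ∈ J, b.repr u j ^ 2 := fun u =>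
    Finset.sum_congr rfl fun j hj => by rw [b.repr_apply_apply, hb j hj]
  have key : ∀ m : ℕ, (∫ u : Metric.sphere (0 : 𝔼 p) 1, (∑ j ∈ J, inner ℝ (v j) (u : 𝔼 p) ^ 2) ^ m
        ∂(volume : Measure (𝔼 p)).toSphere) * (Real.Gamma ((p : ℝ) / 2 + m) / 2) =
      ((volume : Measure (EuclideanSpace ℝ J)).toSphere.real univ *
        (Real.Gamma ((J.card : ℝ) / 2 + m) / 2)) *
        ∫ x : {j // j ∉ J} → ℝ, Real.exp (-∑ j, x j ^ 2) := fun m => by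
    have h1 := integral_homogeneous_mul_exp_neg_sq_norm (volume : Measure (𝔼 p))
      (f := fun u => (∑ j ∈ J, inner ℝ (v j) u ^ 2) ^ m) (d := 2 * m) (fun r x _ => by
        simp_rw [inner_smul_right, mul_pow, ← Finset.mul_sum, mul_pow, pow_mul])
    rw [finrank_euclideanSpace_fin, integral_pow_finrank_mul_exp_neg_sq hp] at h1
    rw [← h1]
    have h2 := integral_coordinate_block_mul_exp_neg_sq_norm J m
    rw [integral_sq_norm_pow_mul_exp_neg_sq_norm] at h2
    simp only [finrank_euclideanSpace, Fintype.card_coe] at h2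
    have h3 := b.repr.measurePreserving.integral_comp b.repr.toHomeomorph.measurableEmbedding
      (fun x => (∑ j ∈ J, x j ^ 2) ^ m * Real.exp (-‖x‖ ^ 2))
    rw [← h2, ← h3]
    simp_rw [hbv, b.repr.norm_map]
  have hm := key m
  -- The case `m = 0` is the normalisation: dividing by it removes the area of the smaller sphere
  -- and the Gaussian integral over the complement.
  have h0 := key 0
  simp only [pow_zero, integral_const, smul_eq_mul, mul_one, Nat.cast_zero, add_zero] at h0
  have hp' : (0 : ℝ) < p := by exact_mod_cast hp
  have hk' : (0 : ℝ) < J.card := by exact_mod_cast hk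
  have hσ := toSphere_real_univ_pos hp
  have g1 := Real.Gamma_pos_of_pos (half_pos hp')
  have g2 := Real.Gamma_pos_of_pos (half_pos hk')
  have g3 := Real.Gamma_pos_of_pos (by positivity : 0 < (p : ℝ) / 2 + m)
  rw [integral_uniformSphere, betaMoment, inv_mul_eq_div, div_eq_div_iff hσ.ne' (by positivity)]
  refine mul_right_cancel₀ g1.ne' ?_
  linear_combination (2 * Real.Gamma ((J.card : ℝ) / 2) * Real.Gamma ((p : ℝ) / 2)) * hm
    - (2 * Real.Gamma ((J.card : ℝ) / 2 + m) * Real.Gamma ((p : ℝ) / 2)) * h0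

/-- The Gaussian-weighted integral of an odd function vanishes, and its radial factor in polar
coordinates is positive, so the spherical factor is zero. -/
theorem integral_inner_uniformSphere {p : ℕ} (hp : 0 < p) (v : 𝔼 p) :
    ∫ u, inner ℝ v u ∂(uniformSphere p) = 0 := by
  have := euclideanSpace_nontrivial hp
  have h1 := integral_homogeneous_mul_exp_neg_sq_norm (volume : Measure (𝔼 p))
    (f := fun u => inner ℝ v u) (d := 1) (fun r x _ => by simp [inner_smul_right])
  have h2 := integral_neg_eq_self (fun x : 𝔼 p => inner ℝ v x * Real.exp (-‖x‖ ^ 2)) volume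
  simp only [inner_neg_right, norm_neg, neg_mul, integral_neg] at h2
  rw [integral_pow_mul_exp_neg_sq] at h1
  have h3 : (0 : ℝ) < Real.Gamma ((((finrank ℝ (𝔼 p) - 1 + 1 : ℕ) : ℝ) + 1) / 2) :=
    Real.Gamma_pos_of_pos (by positivity)
  have h4 : ∫ x : 𝔼 p, inner ℝ v x * Real.exp (-‖x‖ ^ 2) = 0 := by linarith
  rw [h4] at h1
  rcases mul_eq_zero.1 h1.symm with h | h
  · rw [integral_uniformSphere (fun u => inner ℝ v u), h, mul_zero]
  · linarith

/-- This is the one-vector block with `m = 1`, where the Beta moment is `1/p`. -/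
theorem integral_inner_sq_uniformSphere {p : ℕ} (hp : 0 < p) (v : 𝔼 p) :
    ∫ u, inner ℝ v u ^ 2 ∂(uniformSphere p) = ‖v‖ ^ 2 / p := by
  rcases eq_or_ne v 0 with rfl | hv
  · simp
  have hv' : ‖v‖ ≠ 0 := norm_ne_zero_iff.2 hv
  have hon : Orthonormal ℝ ((({⟨0, hp⟩} : Finset (Fin p)) : Set (Fin p)).domRestrict
      fun _ => ‖v‖⁻¹ • v) := by
    constructor
    · rintro ⟨i, hi⟩
      simp [norm_smul, hv', Set.domRestrict]
    · rintro ⟨i, hi⟩ ⟨j, hj⟩ hij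
      simp only [Finset.coe_singleton, mem_singleton_iff] at hi hj
      subst hi hj
      exact absurd rfl hij
  have h := integral_orthonormal_block_uniformSphere (Finset.singleton_nonempty _) hon 1
  rw [betaMoment_succ 0 (by simp) hp, betaMoment_zero (by simp) hp] at h
  simp only [Finset.sum_singleton, pow_one, inner_smul_left, mul_pow, integral_const_mul,
    Finset.card_singleton] at h
  simp only [conj_trivial, Nat.cast_one, Nat.cast_zero, mul_zero, add_zero, one_mul] at h
  field_simp at h
  rw [eq_div_iff (by positivity)]
  linarith

theorem integral_inner_mul_inner_uniformSphere {p : ℕ} (hp : 0 < p) (v w : 𝔼 p) :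
    ∫ u, inner ℝ v u * inner ℝ w u ∂(uniformSphere p) = inner ℝ v w / p := by
  have h : ∀ u : 𝔼 p, inner ℝ v u * inner ℝ w u =
      4⁻¹ * (inner ℝ (v + w) u ^ 2 - inner ℝ (v - w) u ^ 2) := fun u => by
    rw [inner_add_left, inner_sub_left]
    ring
  simp_rw [h]
  rw [integral_const_mul, integral_sub (integrable_uniformSphere hp (by fun_prop))
    (integrable_uniformSphere hp (by fun_prop)), integral_inner_sq_uniformSphere hp,
    integral_inner_sq_uniformSphere hp, norm_add_sq_real, norm_sub_sq_real]
  ring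

end UniformSphere

/-! ### Moments of the elliptical law -/

section EllipticalLaw

variable {p : ℕ} {Sig : Matrix (Fin p) (Fin p) ℝ} {nu : Measure ℝ}

/-- The rows of the positive semidefinite square root. -/
noncomputable def sqrtRow (Sig : Matrix (Fin p) (Fin p) ℝ) (j : Fin p) :
    EuclideanSpace ℝ (Fin p) :=
  WithLp.toLp 2 (CFC.sqrt Sig j)

theorem inner_sqrtRow (Sig : Matrix (Fin p) (Fin p) ℝ) (j : Fin p)
    (u : EuclideanSpace ℝ (Fin p)) :
    inner ℝ (sqrtRow Sig j) u = (CFC.sqrt Sig *ᵥ WithLp.ofLp u) j := by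
  simp [sqrtRow, PiLp.inner_apply, Matrix.mulVec, dotProduct, mul_comm]

theorem inner_sqrtRow_sqrtRow (hSig : Sig.PosSemidef) (j k : Fin p) :
    inner ℝ (sqrtRow Sig j) (sqrtRow Sig k) = Sig j k := by
  have h1 : CFC.sqrt Sig * CFC.sqrt Sig = Sig :=
    CFC.sqrt_mul_sqrt_self Sig (Matrix.nonneg_iff_posSemidef.2 hSig)
  have h2 : (CFC.sqrt Sig).IsHermitian :=
    (Matrix.nonneg_iff_posSemidef.1 (CFC.sqrt_nonneg Sig)).isHermitian
  rw [inner_sqrtRow]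
  conv_rhs => rw [← h1]
  simp only [Matrix.mulVec, dotProduct, Matrix.mul_apply, sqrtRow]
  refine Finset.sum_congr rfl fun i _ => ?_
  rw [← h2.apply k i]
  simp

theorem integral_ellipticalLaw (mu : EuclideanSpace ℝ (Fin p)) (Sig : Matrix (Fin p) (Fin p) ℝ)
    (nu : Measure ℝ) {f : EuclideanSpace ℝ (Fin p) → ℝ} (hf : Continuous f) :
    ∫ y, f (y - mu) ∂(ellipticalLaw mu Sig nu) =
      ∫ z, f (z.1 • WithLp.toLp 2 (CFC.sqrt Sig *ᵥ WithLp.ofLp z.2))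
        ∂(nu.prod (uniformSphere p)) := by
  rw [ellipticalLaw, integral_map]
  · simp
  · refine Continuous.aemeasurable ?_
    refine continuous_const.add (continuous_fst.smul ?_)
    exact (PiLp.continuous_toLp 2 _).comp
      (continuous_const.matrix_mulVec ((PiLp.continuous_ofLp 2 _).comp continuous_snd))
  · exact (hf.comp (continuous_id.sub continuous_const)).aestronglyMeasurable

theorem integral_coordinate_ellipticalLaw (hp : 0 < p) (mu : EuclideanSpace ℝ (Fin p))
    (hnu : IsRadialLaw p nu) (j : Fin p) :
    ∫ y, (y j - mu j) ∂(ellipticalLaw mu Sig nu) = 0 := by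
  have := hnu.isProbabilityMeasure
  have := isProbabilityMeasure_uniformSphere hp
  have h := integral_ellipticalLaw mu Sig nu (f := fun x => x j) (by fun_prop)
  simp only [PiLp.sub_apply] at h
  rw [h]
  simp only [PiLp.smul_apply, smul_eq_mul, ← inner_sqrtRow]
  rw [integral_prod_mul (fun r : ℝ => r) (fun u => inner ℝ (sqrtRow Sig j) u),
    integral_inner_uniformSphere hp, mul_zero]

theorem integral_coordinate_mul_coordinate_ellipticalLaw (hp : 0 < p)
    (mu : EuclideanSpace ℝ (Fin p)) (hSig : Sig.PosSemidef) (hnu : IsRadialLaw p nu)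
    (j k : Fin p) :
    ∫ y, (y j - mu j) * (y k - mu k) ∂(ellipticalLaw mu Sig nu) = Sig j k := by
  have := hnu.isProbabilityMeasure
  have := isProbabilityMeasure_uniformSphere hp
  have h := integral_ellipticalLaw mu Sig nu (f := fun x => x j * x k) (by fun_prop)
  simp only [PiLp.sub_apply] at h
  rw [h]
  simp only [PiLp.smul_apply, smul_eq_mul, ← inner_sqrtRow, mul_mul_mul_comm, ← sq]
  rw [integral_prod_mul (fun r : ℝ => r ^ 2)
    (fun u => inner ℝ (sqrtRow Sig j) u * inner ℝ (sqrtRow Sig k) u),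
    integral_inner_mul_inner_uniformSphere hp, inner_sqrtRow_sqrtRow hSig, hnu.second_moment]
  have : (p : ℝ) ≠ 0 := by exact_mod_cast hp.ne'
  field_simp

theorem continuous_blockForm (M : Matrix (Fin p) (Fin p) ℝ) (J : Finset (Fin p)) :
    Continuous fun v : EuclideanSpace ℝ (Fin p) => blockForm v M J := by
  unfold blockForm dotProduct Matrix.mulVec dotProduct
  fun_prop

/-- Factor the inverse block as `RᵀR`. The rows of the square root have Gram matrix `Sig`, so
recombining the rows in `J` with coefficients `R` gives the Gram matrix `R Sig_JJ Rᵀ = 1`, and the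
quadratic form becomes a sum of squared inner products with these vectors. -/
theorem exists_orthonormal_blockForm (hSig : Sig.PosSemidef) {J : Finset (Fin p)}
    (hpos : (diagBlock Sig J).PosDef) :
    ∃ v : Fin p → EuclideanSpace ℝ (Fin p), Orthonormal ℝ ((J : Set (Fin p)).domRestrict v) ∧
      ∀ (r : ℝ) (u : EuclideanSpace ℝ (Fin p)),
        blockForm (r • WithLp.toLp 2 (CFC.sqrt Sig *ᵥ WithLp.ofLp u)) Sig J =
          r ^ 2 * ∑ j ∈ J, inner ℝ (v j) u ^ 2 := by
  obtain ⟨R, hR⟩ := CStarAlgebra.nonneg_iff_eq_star_mul_self.1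
    hpos.inv.posSemidef.nonneg
  rw [Matrix.star_eq_conjTranspose, Matrix.conjTranspose_eq_transpose_of_trivial] at hR
  have hunit : IsUnit (diagBlock Sig J).det := hpos.det_pos.ne'.isUnit
  have hRR : R * diagBlock Sig J * Rᵀ = 1 := by
    -- For square matrices the claim is equivalent to `Rᵀ R Sig_JJ = 1`, which is the inverse times
    -- the block.
    rw [mul_eq_one_comm, ← Matrix.mul_assoc, ← hR, Matrix.nonsing_inv_mul _ hunit]
  let w : J → EuclideanSpace ℝ (Fin p) := fun i => ∑ k : J, R i k • sqrtRow Sig k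
  have hw : ∀ i j, inner ℝ (w i) (w j) = if i = j then 1 else 0 := fun i j => by
    have h : (R * diagBlock Sig J * Rᵀ) i j = (1 : Matrix J J ℝ) i j := by rw [hRR]
    rw [Matrix.one_apply] at h
    rw [← h]
    simp only [w, sum_inner, inner_sum, inner_smul_left, inner_smul_right,
      inner_sqrtRow_sqrtRow hSig, Matrix.mul_apply, Matrix.transpose_apply, diagBlock,
      Matrix.submatrix_apply, Finset.sum_mul, Finset.mul_sum, conj_trivial]
    refine Finset.sum_congr rfl fun k _ => Finset.sum_congr rfl fun l _ => by ring
  refine ⟨fun j => if h : j ∈ J then w ⟨j, h⟩ else 0, ?_, fun r u => ?_⟩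
  · rw [orthonormal_iff_ite]
    rintro ⟨i, hi⟩ ⟨j, hj⟩
    have hi' : i ∈ J := hi
    have hj' : j ∈ J := hj
    simp [Set.domRestrict, hi', hj', hw]
  · have h1 : ∀ i : J, (R *ᵥ fun j : J => (CFC.sqrt Sig *ᵥ WithLp.ofLp u) j) i =
        inner ℝ (w i) u := fun i => by
      simp only [w, sum_inner, inner_smul_left, inner_sqrtRow, Matrix.mulVec, dotProduct,
        conj_trivial]
    have h2 : ∀ x : J → ℝ, x ⬝ᵥ ((Rᵀ * R) *ᵥ x) = ∑ i, (R *ᵥ x) i ^ 2 := fun x => by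
      rw [← Matrix.mulVec_mulVec, Matrix.dotProduct_mulVec, Matrix.vecMul_transpose]
      simp [dotProduct, sq]
    have h3 : (fun j : J => (r • WithLp.toLp 2 (CFC.sqrt Sig *ᵥ WithLp.ofLp u)) j) =
        r • fun j : J => (CFC.sqrt Sig *ᵥ WithLp.ofLp u) j := by
      ext j
      simp
    rw [blockForm, hR, h3, Matrix.mulVec_smul, dotProduct_smul, smul_dotProduct, h2]
    simp_rw [h1]
    rw [← Finset.sum_coe_sort J, smul_eq_mul, smul_eq_mul, ← mul_assoc, ← sq]
    simp

theorem integral_blockForm_pow_ellipticalLaw (mu : EuclideanSpace ℝ (Fin p))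
    (hSig : Sig.PosSemidef) (hnu : IsRadialLaw p nu) {J : Finset (Fin p)} (hJ : J.Nonempty)
    (hpos : (diagBlock Sig J).PosDef) (m : ℕ) :
    ∫ y, blockForm (y - mu) Sig J ^ m ∂(ellipticalLaw mu Sig nu) =
      cStar p m J.card * scaledMoment p m nu := by
  have hkp : J.card ≤ p := by simpa using J.card_le_univ
  have hp : 0 < p := hJ.card_pos.trans_le hkp
  have := hnu.isProbabilityMeasure
  have := isProbabilityMeasure_uniformSphere hp
  obtain ⟨v, hv, hform⟩ := exists_orthonormal_blockForm hSig hpos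
  rw [integral_ellipticalLaw mu Sig nu (f := fun x => blockForm x Sig J ^ m)
    ((continuous_blockForm Sig J).pow m)]
  simp_rw [hform, mul_pow, ← pow_mul]
  rw [integral_prod_mul (fun r : ℝ => r ^ (2 * m))
    (fun u => (∑ j ∈ J, inner ℝ (v j) u ^ 2) ^ m),
    integral_orthonormal_block_uniformSphere hJ hv, cStar_eq m hJ.card_pos hkp, scaledMoment]
  have : (p : ℝ) ≠ 0 := by exact_mod_cast hp.ne'
  field_simp

/-- The eigenvalue bound concerns blocks of size exactly `K`. A smaller block is enlarged to such a
block and the vector is padded with zeros, which changes neither side. -/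
theorem le_dotProduct_diagBlock_mulVec (hSig : Sig.PosSemidef) {K : ℕ} {c : ℝ} (hKp : K ≤ p)
    (heig : ∀ J : Finset (Fin p), J.card = K → ∀ l ∈ spectrum ℝ (diagBlock Sig J), c ≤ l)
    {J : Finset (Fin p)} (hJ : J.card ≤ K) (x : J → ℝ) :
    c * (x ⬝ᵥ x) ≤ x ⬝ᵥ (diagBlock Sig J *ᵥ x) := by
  obtain ⟨I, hJI, hI⟩ := Finset.exists_superset_card_eq hJ (by simpa using hKp)
  have hsa : IsSelfAdjoint (diagBlock Sig I) :=
    (hSig.submatrix (Subtype.val : I → Fin p)).isHermitian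
  have h1 := (algebraMap_le_iff_le_spectrum (a := diagBlock Sig I) hsa).2 (heig I hI)
  rw [Matrix.le_iff] at h1
  let z : Fin p → ℝ := fun i => if h : i ∈ J then x ⟨i, h⟩ else 0
  have hz : ∀ i : J, z i = x i := fun i => by simp [z]
  have hz0 : ∀ i ∉ J, z i = 0 := fun i hi => by simp [z, hi]
  have hsum : ∀ f : Fin p → ℝ, ∑ i : I, z i * f i = ∑ i : J, x i * f i := fun f => by
    rw [Finset.sum_coe_sort I (fun i => z i * f i)]
    simp_rw [← hz]
    rw [Finset.sum_coe_sort J (fun i => z i * f i)]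
    exact (Finset.sum_subset hJI fun i _ hi => by rw [hz0 i hi, zero_mul]).symm
  have h2 := h1.dotProduct_mulVec_nonneg (fun i : I => z i)
  rw [Matrix.sub_mulVec, dotProduct_sub, sub_nonneg, Algebra.algebraMap_eq_smul_one,
    Matrix.smul_mulVec, Matrix.one_mulVec, dotProduct_smul, star_trivial, smul_eq_mul] at h2
  have h3 : (fun i : I => z i) ⬝ᵥ (fun i : I => z i) = x ⬝ᵥ x := by
    simp only [dotProduct]
    rw [hsum z]
    simp_rw [hz]
  have h4 : (fun i : I => z i) ⬝ᵥ (diagBlock Sig I *ᵥ fun i : I => z i) =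
      x ⬝ᵥ (diagBlock Sig J *ᵥ x) := by
    simp only [dotProduct, Matrix.mulVec, diagBlock, Matrix.submatrix_apply]
    rw [hsum fun i => ∑ k : I, Sig i k * z k]
    refine Finset.sum_congr rfl fun i _ => ?_
    simp_rw [mul_comm (Sig _ _)]
    rw [hsum fun k => Sig i k]
  rwa [h3, h4] at h2

end EllipticalLaw

/-! ### Even moments of sums of independent variables -/

section Moments

variable {Ω : Type*} [MeasurableSpace Ω] {P : Measure Ω}

/-- All absolute moments of natural order are finite. -/
def HasAllMoments (X : Ω → ℝ) (P : Measure Ω) : Prop := ∀ q : ℕ, MemLp X q P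

namespace HasAllMoments

variable {X Y : Ω → ℝ}

theorem aemeasurable (hX : HasAllMoments X P) : AEMeasurable X P :=
  (hX 0).aestronglyMeasurable.aemeasurable

theorem integrable (hX : HasAllMoments X P) : Integrable X P :=
  memLp_one_iff_integrable.1 (by simpa using hX 1)

theorem const [IsFiniteMeasure P] (a : ℝ) : HasAllMoments (fun _ : Ω => a) P :=
  fun _ => memLp_const a

theorem add (hX : HasAllMoments X P) (hY : HasAllMoments Y P) :
    HasAllMoments (fun ω => X ω + Y ω) P := fun q => (hX q).add (hY q)

theorem sub (hX : HasAllMoments X P) (hY : HasAllMoments Y P) :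
    HasAllMoments (fun ω => X ω - Y ω) P := fun q => (hX q).sub (hY q)

/-- Hölder's inequality with both exponents `2q`. Variables with all moments therefore form an
algebra, which supplies integrability of every polynomial expression below. -/
theorem mul (hX : HasAllMoments X P) (hY : HasAllMoments Y P) :
    HasAllMoments (fun ω => X ω * Y ω) P := fun q => by
  have : ENNReal.HolderTriple ((2 * q : ℕ) : ℝ≥0∞) ((2 * q : ℕ) : ℝ≥0∞) (q : ℝ≥0∞) := by
    constructor
    push_cast
    rw [ENNReal.mul_inv (by simp) (by simp), ← add_mul, ENNReal.inv_two_add_inv_two, one_mul]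
  exact (hY (2 * q)).mul' (hX (2 * q))

theorem pow [IsFiniteMeasure P] (hX : HasAllMoments X P) (r : ℕ) :
    HasAllMoments (fun ω => X ω ^ r) P := by
  induction r with
  | zero => simpa using const 1
  | succ r ih => simpa only [pow_succ] using ih.mul hX

theorem sum {ι : Type*} {X : ι → Ω → ℝ} (s : Finset ι) (hX : ∀ i ∈ s, HasAllMoments (X i) P) :
    HasAllMoments (fun ω => ∑ i ∈ s, X i ω) P := fun q => memLp_finsetSum s fun i hi => hX i hi q

theorem const_mul (a : ℝ) (hX : HasAllMoments X P) :
    HasAllMoments (fun ω => a * X ω) P := fun q => (hX q).const_mul a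

end HasAllMoments

/-- The terms of degree at least two in `x` of the binomial expansion are bounded by `s^{2r} x²` if
`|x| ≤ |s|` and by `x^{2r+2}` otherwise; their coefficients add up to at most `4^{r+1}`. The linear
term is kept because its expectation will vanish. -/
theorem add_pow_even_le (s x : ℝ) (r : ℕ) :
    (s + x) ^ (2 * (r + 1)) ≤ s ^ (2 * (r + 1)) + (2 * (r + 1) : ℕ) * (s ^ (2 * r + 1) * x) +
      4 ^ (r + 1) * (s ^ (2 * r) * x ^ 2 + x ^ (2 * (r + 1))) := by
  have hterm : ∀ k ≤ 2 * r, x ^ (k + 2) * s ^ (2 * r - k) ≤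
      s ^ (2 * r) * x ^ 2 + x ^ (2 * (r + 1)) := fun k hk => by
    have h0 : 0 ≤ s ^ (2 * r) * x ^ 2 := mul_nonneg (by rw [pow_mul]; positivity) (sq_nonneg x)
    have h0' : 0 ≤ x ^ (2 * (r + 1)) := by rw [pow_mul]; positivity
    refine (le_abs_self _).trans ?_
    rw [abs_mul, abs_pow, abs_pow]
    rcases le_total |x| |s| with h | h
    · have : |x| ^ (k + 2) * |s| ^ (2 * r - k) ≤ s ^ (2 * r) * x ^ 2 := by
        calc |x| ^ (k + 2) * |s| ^ (2 * r - k) = |x| ^ k * |s| ^ (2 * r - k) * |x| ^ 2 := by ring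
          _ ≤ |s| ^ k * |s| ^ (2 * r - k) * |x| ^ 2 := by gcongr
          _ = s ^ (2 * r) * x ^ 2 := by
            rw [← pow_add, Nat.add_sub_cancel' hk, sq_abs, pow_mul, sq_abs, pow_mul]
      linarith
    · have : |x| ^ (k + 2) * |s| ^ (2 * r - k) ≤ x ^ (2 * (r + 1)) := by
        calc |x| ^ (k + 2) * |s| ^ (2 * r - k) ≤ |x| ^ (k + 2) * |x| ^ (2 * r - k) := by gcongr
          _ = x ^ (2 * (r + 1)) := by
            rw [← pow_add, show k + 2 + (2 * r - k) = 2 * (r + 1) by omega, pow_mul, sq_abs,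
              pow_mul]
      linarith
  rw [add_comm s x, add_pow, show 2 * (r + 1) + 1 = (2 * r + 1) + 1 + 1 by ring,
    Finset.sum_range_succ', Finset.sum_range_succ']
  have hbound : ∑ k ∈ Finset.range (2 * r + 1), x ^ (k + 1 + 1) *
      s ^ (2 * (r + 1) - (k + 1 + 1)) * ((2 * (r + 1)).choose (k + 1 + 1) : ℝ) ≤
      4 ^ (r + 1) * (s ^ (2 * r) * x ^ 2 + x ^ (2 * (r + 1))) := by
    have hnn : 0 ≤ s ^ (2 * r) * x ^ 2 + x ^ (2 * (r + 1)) := by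
      rw [pow_mul, pow_mul]; positivity
    calc _ ≤ ∑ k ∈ Finset.range (2 * r + 1), (s ^ (2 * r) * x ^ 2 + x ^ (2 * (r + 1))) *
          ((2 * (r + 1)).choose (k + 1 + 1) : ℝ) := by
          refine Finset.sum_le_sum fun k hk => ?_
          rw [show 2 * (r + 1) - (k + 1 + 1) = 2 * r - k by omega]
          exact mul_le_mul_of_nonneg_right
            (hterm k (Nat.lt_succ_iff.1 (Finset.mem_range.1 hk))) (Nat.cast_nonneg _)
      _ = (s ^ (2 * r) * x ^ 2 + x ^ (2 * (r + 1))) *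
          ∑ k ∈ Finset.range (2 * r + 1), ((2 * (r + 1)).choose (k + 1 + 1) : ℝ) := by
          rw [Finset.mul_sum]
      _ ≤ (s ^ (2 * r) * x ^ 2 + x ^ (2 * (r + 1))) * 4 ^ (r + 1) := by
          refine mul_le_mul_of_nonneg_left ?_ hnn
          have h := Nat.sum_range_choose (2 * (r + 1))
          rw [show 2 * (r + 1) + 1 = (2 * r + 1) + 1 + 1 by ring, Finset.sum_range_succ',
            Finset.sum_range_succ', pow_mul] at h
          have h' : ∑ k ∈ Finset.range (2 * r + 1), (2 * (r + 1)).choose (k + 1 + 1) ≤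
            4 ^ (r + 1) := by norm_num at h ⊢; omega
          exact_mod_cast h'
      _ = _ := mul_comm _ _
  have e : 2 * (r + 1) - (0 + 1) = 2 * r + 1 := by omega
  simp only [zero_add, pow_one, pow_zero, Nat.choose_one_right, Nat.choose_zero_right,
    Nat.sub_zero, one_mul, Nat.cast_one, mul_one, e] at hbound ⊢
  nlinarith [hbound]

/-- The constant in the bound for even moments of sums of independent centred variables. -/
noncomputable def evenMomentConst (B : ℝ) : ℕ → ℝ
  | 0 => 1
  | r + 1 => 4 ^ (r + 1) * (evenMomentConst B r * B + B)

theorem evenMomentConst_nonneg {B : ℝ} (hB : 0 ≤ B) (r : ℕ) : 0 ≤ evenMomentConst B r := by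
  induction r with
  | zero => simp [evenMomentConst]
  | succ r ih => rw [evenMomentConst]; positivity

/-- Induction on `r`, and for each `r` on the index set. By independence and centring the linear
term has mean zero, so a new summand raises the moment of order `2(r+1)` by `O(|s|^r)` through the
bound of order `2r`; adding these increments gives `|s|^{r+1}`. -/
theorem integral_sum_pow_even_le [IsProbabilityMeasure P] {ι : Type*} {X : ι → Ω → ℝ}
    (hL : ∀ i, HasAllMoments (X i) P) (hind : iIndepFun X P) (hmean : ∀ i, ∫ ω, X i ω ∂P = 0)
    {R : ℕ} {B : ℝ} (hB0 : 0 ≤ B) (hB : ∀ i, ∀ r ≤ R, ∫ ω, X i ω ^ (2 * r) ∂P ≤ B)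
    {r : ℕ} (hr : r ≤ R) (s : Finset ι) :
    ∫ ω, (∑ i ∈ s, X i ω) ^ (2 * r) ∂P ≤ evenMomentConst B r * (s.card : ℝ) ^ r := by
  classical
  induction r generalizing s with
  | zero => simp [evenMomentConst]
  | succ r ihr =>
    induction s using Finset.induction_on with
    | empty => simp
    | insert i s hi ihs =>
      have hS : HasAllMoments (fun ω => ∑ j ∈ s, X j ω) P := HasAllMoments.sum s fun j _ => hL j
      have hindep : IndepFun (fun ω => ∑ j ∈ s, X j ω) (X i) P := by
        have := hind.indepFun_finsetSum_of_notMem₀ (fun j => (hL j).aemeasurable) hi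
        rwa [Finset.sum_fn] at this
      have hprod : ∀ a b : ℕ, ∫ ω, (∑ j ∈ s, X j ω) ^ a * X i ω ^ b ∂P =
          (∫ ω, (∑ j ∈ s, X j ω) ^ a ∂P) * ∫ ω, X i ω ^ b ∂P := fun a b =>
        (hindep.comp (measurable_id.pow_const a)
          (measurable_id.pow_const b)).integral_fun_mul_eq_mul_integral
          (hS.pow a).aemeasurable.aestronglyMeasurable
          ((hL i).pow b).aemeasurable.aestronglyMeasurable
      have hint : ∀ a b : ℕ, Integrable (fun ω => (∑ j ∈ s, X j ω) ^ a * X i ω ^ b) P :=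
        fun a b => ((hS.pow a).mul ((hL i).pow b)).integrable
      have h1 := hprod (2 * r + 1) 1
      simp only [pow_one] at h1
      rw [hmean i, mul_zero] at h1
      have h2 := hprod (2 * r) 2
      have hi1 := hint (2 * r + 1) 1
      simp only [pow_one] at hi1
      have hA : Integrable (fun ω => (∑ j ∈ s, X j ω) ^ (2 * (r + 1))) P := (hS.pow _).integrable
      have hI : Integrable (fun ω => (2 * (r + 1) : ℕ) *
          ((∑ j ∈ s, X j ω) ^ (2 * r + 1) * X i ω)) P := hi1.const_mul _
      have hXr : Integrable (fun ω => X i ω ^ (2 * (r + 1))) P := ((hL i).pow _).integrable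
      have hAI : Integrable (fun ω => (∑ j ∈ s, X j ω) ^ (2 * (r + 1)) + (2 * (r + 1) : ℕ) *
          ((∑ j ∈ s, X j ω) ^ (2 * r + 1) * X i ω)) P := hA.add hI
      have hJ : Integrable (fun ω => 4 ^ (r + 1) * ((∑ j ∈ s, X j ω) ^ (2 * r) * X i ω ^ 2 +
          X i ω ^ (2 * (r + 1)))) P := ((hint _ _).add hXr).const_mul _
      have hstep : ∫ ω, (∑ j ∈ insert i s, X j ω) ^ (2 * (r + 1)) ∂P ≤
          ∫ ω, (∑ j ∈ s, X j ω) ^ (2 * (r + 1)) ∂P +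
            4 ^ (r + 1) * ((∫ ω, (∑ j ∈ s, X j ω) ^ (2 * r) ∂P) * (∫ ω, X i ω ^ 2 ∂P) +
              ∫ ω, X i ω ^ (2 * (r + 1)) ∂P) := by
        calc _ ≤ ∫ ω, ((∑ j ∈ s, X j ω) ^ (2 * (r + 1)) +
              (2 * (r + 1) : ℕ) * ((∑ j ∈ s, X j ω) ^ (2 * r + 1) * X i ω) +
              4 ^ (r + 1) * ((∑ j ∈ s, X j ω) ^ (2 * r) * X i ω ^ 2 +
                X i ω ^ (2 * (r + 1)))) ∂P := by
              refine integral_mono ?_ ?_ fun ω => ?_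
              · exact ((HasAllMoments.sum _ fun j _ => hL j).pow _).integrable
              · exact hAI.add hJ
              · simp only [Finset.sum_insert hi]
                rw [add_comm (X i ω)]
                exact add_pow_even_le _ _ _
          _ = _ := by
              rw [integral_add hAI hJ, integral_add hA hI, integral_const_mul,
                integral_const_mul, h1, integral_add (hint _ _) hXr, h2, mul_zero, add_zero]
      have hB1 := hB i 1 (by omega)
      have hBr := hB i (r + 1) hr
      have hSr := ihr (by omega) s
      have hc := evenMomentConst_nonneg hB0 r
      have hsq : 0 ≤ ∫ ω, X i ω ^ 2 ∂P := integral_nonneg fun ω => sq_nonneg _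
      rw [mul_one] at hB1
      rw [Finset.card_insert_of_notMem hi]
      push_cast
      have hn : (0 : ℝ) ≤ s.card := Nat.cast_nonneg _
      have hpow : (s.card : ℝ) ^ r ≤ ((s.card : ℝ) + 1) ^ r := by gcongr; linarith
      have hone : 1 ≤ ((s.card : ℝ) + 1) ^ r := one_le_pow₀ (by linarith)
      have hmain : (∫ ω, (∑ j ∈ s, X j ω) ^ (2 * r) ∂P) * (∫ ω, X i ω ^ 2 ∂P) +
          ∫ ω, X i ω ^ (2 * (r + 1)) ∂P ≤
          (evenMomentConst B r * B + B) * ((s.card : ℝ) + 1) ^ r := by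
        have : (∫ ω, (∑ j ∈ s, X j ω) ^ (2 * r) ∂P) * (∫ ω, X i ω ^ 2 ∂P) ≤
            (evenMomentConst B r * ((s.card : ℝ) + 1) ^ r) * B :=
          mul_le_mul (hSr.trans (by gcongr)) hB1 hsq (by positivity)
        nlinarith
      have hD : evenMomentConst B (r + 1) = 4 ^ (r + 1) * (evenMomentConst B r * B + B) := rfl
      have hD0 := evenMomentConst_nonneg hB0 (r + 1)
      have hmain' := mul_le_mul_of_nonneg_left hmain (by positivity : (0 : ℝ) ≤ 4 ^ (r + 1))
      rw [← mul_assoc, ← hD] at hmain'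
      calc _ ≤ _ := hstep
        _ ≤ evenMomentConst B (r + 1) * (s.card : ℝ) ^ (r + 1) +
            evenMomentConst B (r + 1) * ((s.card : ℝ) + 1) ^ r := add_le_add ihs hmain'
        _ ≤ evenMomentConst B (r + 1) * ((s.card : ℝ) + 1) ^ (r + 1) := by
            rw [← mul_add]
            refine mul_le_mul_of_nonneg_left ?_ hD0
            rw [pow_succ, pow_succ]
            nlinarith

theorem integral_average_pow_even_le [IsProbabilityMeasure P] {n : ℕ} (hn : 0 < n)
    {X : Fin n → Ω → ℝ}
    (hL : ∀ i, HasAllMoments (X i) P) (hind : iIndepFun X P) (hmean : ∀ i, ∫ ω, X i ω ∂P = 0)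
    {r : ℕ} {B : ℝ} (hB0 : 0 ≤ B) (hB : ∀ i, ∀ q ≤ r, ∫ ω, X i ω ^ (2 * q) ∂P ≤ B) :
    ∫ ω, ((n : ℝ)⁻¹ * ∑ i, X i ω) ^ (2 * r) ∂P ≤ evenMomentConst B r / (n : ℝ) ^ r := by
  have hn' : (0 : ℝ) < n := by exact_mod_cast hn
  have h := integral_sum_pow_even_le hL hind hmean hB0 hB le_rfl Finset.univ
  simp_rw [mul_pow]
  rw [integral_const_mul, Finset.card_univ, Fintype.card_fin] at *
  calc _ ≤ ((n : ℝ)⁻¹) ^ (2 * r) * (evenMomentConst B r * (n : ℝ) ^ r) := by gcongr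
    _ = _ := by
      rw [inv_pow, two_mul, pow_add]
      field_simp

theorem hasAllMoments_of_psiNorm_le [IsProbabilityMeasure P] {X : Ω → ℝ} (hX : AEMeasurable X P)
    {C : ℝ} (h : psiNorm X P ≤ ENNReal.ofReal C) : HasAllMoments X P := fun q => by
  -- The supremum in `psiNorm` starts at order `1`, so order `q + 1` is used to cover `q = 0`.
  refine MemLp.mono_exponent (q := ((q + 1 : ℕ) : ℝ≥0∞)) ⟨hX.aestronglyMeasurable, ?_⟩
    (by exact_mod_cast q.le_succ)
  have h1 : eLpNorm X ((q + 1 : ℕ) : ℝ≥0∞) P / ((q + 1 : ℕ) : ℝ≥0∞) ≤ ENNReal.ofReal C :=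
    (le_iSup₂ (f := fun (k : ℕ) (_ : 1 ≤ k) => eLpNorm X (k : ℝ≥0∞) P / (k : ℝ≥0∞))
      (q + 1) (by omega)).trans h
  rw [ENNReal.div_le_iff (by simp) (by simp)] at h1
  exact h1.trans_lt (ENNReal.mul_lt_top ENNReal.ofReal_lt_top (by simp))

/-- This is the term of order `2r` of the supremum, raised to the power `2r`. The maximum with `0`
appears because `ENNReal.ofReal` truncates a negative `C`. -/
theorem integral_pow_even_le_of_psiNorm_le [IsProbabilityMeasure P] {X : Ω → ℝ}
    (hX : AEMeasurable X P) {C : ℝ} (h : psiNorm X P ≤ ENNReal.ofReal C) (r : ℕ) :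
    ∫ ω, X ω ^ (2 * r) ∂P ≤ (2 * r * max C 0) ^ (2 * r) := by
  rcases Nat.eq_zero_or_pos r with rfl | hr
  · simp
  have h1 : eLpNorm X ((2 * r : ℕ) : ℝ≥0∞) P / ((2 * r : ℕ) : ℝ≥0∞) ≤ ENNReal.ofReal C :=
    (le_iSup₂ (f := fun (k : ℕ) (_ : 1 ≤ k) => eLpNorm X (k : ℝ≥0∞) P / (k : ℝ≥0∞))
      (2 * r) (by omega)).trans h
  have hr0 : ((2 * r : ℕ) : ℝ≥0∞) ≠ 0 := by exact_mod_cast (by omega : 2 * r ≠ 0)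
  rw [ENNReal.div_le_iff hr0 (ENNReal.natCast_ne_top _)] at h1
  have hL := hasAllMoments_of_psiNorm_le hX h (2 * r)
  rw [hL.eLpNorm_eq_integral_rpow_norm hr0 (ENNReal.natCast_ne_top _)] at h1
  simp only [ENNReal.toReal_natCast, Real.rpow_natCast] at h1
  have h2 := h1.trans (mul_le_mul_left (ENNReal.ofReal_le_ofReal (le_max_left C 0)) _)
  rw [← ENNReal.ofReal_natCast, ← ENNReal.ofReal_mul (le_max_right C 0),
    ENNReal.ofReal_le_ofReal_iff (by positivity)] at h2
  have h0 : 0 ≤ ∫ ω, ‖X ω‖ ^ (2 * r) ∂P := integral_nonneg fun ω => by positivity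
  have h3 := pow_le_pow_left₀ (Real.rpow_nonneg h0 _) h2 (2 * r)
  rw [Real.rpow_inv_natCast_pow h0 (by omega)] at h3
  simp only [pow_mul, Real.norm_eq_abs, sq_abs] at h3 ⊢
  refine h3.trans (le_of_eq ?_)
  push_cast
  ring

end Moments

/-! ### Perturbation of inverse quadratic forms -/

section Perturbation

variable {ι : Type*} [Fintype ι]

theorem dotProduct_self_nonneg_real (x : ι → ℝ) : 0 ≤ x ⬝ᵥ x :=
  Finset.sum_nonneg fun i _ => mul_self_nonneg (x i)

/-- Expand the squared length of `w - κ a`; this replaces Cauchy–Schwarz and avoids square roots. -/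
theorem two_mul_mul_dotProduct_le (κ : ℝ) (w a : ι → ℝ) :
    2 * κ * (w ⬝ᵥ a) ≤ w ⬝ᵥ w + κ ^ 2 * (a ⬝ᵥ a) := by
  have h := dotProduct_self_nonneg_real (w - κ • a)
  simp only [sub_dotProduct, dotProduct_sub, smul_dotProduct, dotProduct_smul, smul_eq_mul,
    dotProduct_comm a w] at h
  nlinarith

theorem abs_dotProduct_mulVec_le {D : Matrix ι ι ℝ} {δ : ℝ} {K : ℕ}
    (hK : Fintype.card ι ≤ K) (hδ : 0 ≤ δ) (hD : ∀ j k, |D j k| ≤ δ) (x y : ι → ℝ) :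
    |x ⬝ᵥ (D *ᵥ y)| ≤ δ * K * ((x ⬝ᵥ x + y ⬝ᵥ y) / 2) := by
  have hK' : (Fintype.card ι : ℝ) ≤ K := by exact_mod_cast hK
  have hxx := dotProduct_self_nonneg_real x
  have hyy := dotProduct_self_nonneg_real y
  calc |x ⬝ᵥ (D *ᵥ y)| = |∑ j, ∑ k, x j * (D j k * y k)| := by
        simp only [dotProduct, Matrix.mulVec, Finset.mul_sum]
    _ ≤ ∑ j, ∑ k, |x j * (D j k * y k)| :=
        (Finset.abs_sum_le_sum_abs _ _).trans
          (Finset.sum_le_sum fun j _ => Finset.abs_sum_le_sum_abs _ _)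
    _ ≤ ∑ j, ∑ k, δ * ((x j * x j + y k * y k) / 2) := by
        refine Finset.sum_le_sum fun j _ => Finset.sum_le_sum fun k _ => ?_
        rw [abs_mul, abs_mul]
        have h1 : |x j| * |y k| ≤ (x j * x j + y k * y k) / 2 := by
          nlinarith [sq_nonneg (|x j| - |y k|), abs_mul_abs_self (x j), abs_mul_abs_self (y k)]
        calc |x j| * (|D j k| * |y k|) = |D j k| * (|x j| * |y k|) := by ring
          _ ≤ δ * ((x j * x j + y k * y k) / 2) :=
            mul_le_mul (hD j k) h1 (by positivity) hδ
    _ = δ * (Fintype.card ι : ℝ) * ((x ⬝ᵥ x + y ⬝ᵥ y) / 2) := by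
        simp only [← Finset.mul_sum, ← Finset.sum_div, Finset.sum_add_distrib, Finset.sum_const,
          Finset.card_univ, nsmul_eq_mul, dotProduct]
        simp_rw [mul_left_comm (x _) (Fintype.card ι : ℝ), ← Finset.mul_sum]
        ring
    _ ≤ _ := by gcongr

theorem abs_dotProduct_le {K : ℕ} (hK : Fintype.card ι ≤ K) {ρ : ℝ} (hρ : 0 ≤ ρ) {v : ι → ℝ}
    (hv : ∀ j, |v j| ≤ ρ) (b : ι → ℝ) : |v ⬝ᵥ b| ≤ ρ * ((K + b ⬝ᵥ b) / 2) := by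
  have hK' : (Fintype.card ι : ℝ) ≤ K := by exact_mod_cast hK
  calc |v ⬝ᵥ b| ≤ ∑ j, |v j * b j| := Finset.abs_sum_le_sum_abs _ _
    _ ≤ ∑ j, ρ * ((1 + b j * b j) / 2) := by
        refine Finset.sum_le_sum fun j _ => ?_
        rw [abs_mul]
        refine mul_le_mul (hv j) ?_ (abs_nonneg _) hρ
        nlinarith [sq_nonneg (|b j| - 1), abs_mul_abs_self (b j)]
    _ = ρ * ((Fintype.card ι + b ⬝ᵥ b) / 2) := by
        simp only [← Finset.mul_sum, ← Finset.sum_div, Finset.sum_add_distrib, Finset.sum_const,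
          Finset.card_univ, nsmul_eq_mul, dotProduct, mul_one]
    _ ≤ _ := by gcongr

theorem dotProduct_self_le_of_abs_le {K : ℕ} (hK : Fintype.card ι ≤ K) {ρ : ℝ}
    {v : ι → ℝ} (hv : ∀ j, |v j| ≤ ρ) : v ⬝ᵥ v ≤ K * ρ ^ 2 := by
  have hK' : (Fintype.card ι : ℝ) ≤ K := by exact_mod_cast hK
  calc v ⬝ᵥ v ≤ ∑ _j : ι, ρ ^ 2 := Finset.sum_le_sum fun j _ => by
        rw [← sq, ← sq_abs]
        exact pow_le_pow_left₀ (abs_nonneg _) (hv j) 2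
    _ = Fintype.card ι * ρ ^ 2 := by simp
    _ ≤ _ := by gcongr

variable {S Sg : Matrix ι ι ℝ} {c δ : ℝ} {K : ℕ}

theorem coercive_of_entrywise_close (hK : Fintype.card ι ≤ K) (hδ : 0 ≤ δ)
    (hclose : ∀ j k, |S j k - Sg j k| ≤ δ) (hδc : K * δ ≤ c / 2)
    (hcoer : ∀ x, c * (x ⬝ᵥ x) ≤ x ⬝ᵥ (Sg *ᵥ x)) (x : ι → ℝ) :
    c / 2 * (x ⬝ᵥ x) ≤ x ⬝ᵥ (S *ᵥ x) := by
  have h := abs_dotProduct_mulVec_le (D := S - Sg) hK hδ hclose x x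
  rw [Matrix.sub_mulVec, dotProduct_sub] at h
  have h1 := (abs_le.1 h).1
  have h2 := hcoer x
  have h3 := mul_le_mul_of_nonneg_right hδc (dotProduct_self_nonneg_real x)
  nlinarith

variable [DecidableEq ι]

theorem isUnit_det_of_coercive {M : Matrix ι ι ℝ} {κ : ℝ} (hκ : 0 < κ)
    (hM : ∀ x, κ * (x ⬝ᵥ x) ≤ x ⬝ᵥ (M *ᵥ x)) : IsUnit M.det := by
  rw [isUnit_iff_ne_zero, Ne, ← Matrix.exists_mulVec_eq_zero_iff]
  rintro ⟨v, hv, hMv⟩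
  have h := hM v
  rw [hMv, dotProduct_zero] at h
  have h0 : v ⬝ᵥ v = 0 :=
    le_antisymm (nonpos_of_mul_nonpos_right h hκ) (dotProduct_self_nonneg_real v)
  exact hv (dotProduct_self_eq_zero.1 h0)

/-- With `a = M⁻¹ w`, coercivity at `a` reads `κ |a|² ≤ w · a`; combined with `2 κ (w · a) ≤ |w|² +
κ² |a|²` this gives all three bounds. Symmetry of `M` plays no role. -/
theorem mulVec_inv_bounds_of_coercive {M : Matrix ι ι ℝ} {κ : ℝ} (hκ : 0 < κ)
    (hM : ∀ x, κ * (x ⬝ᵥ x) ≤ x ⬝ᵥ (M *ᵥ x)) (w : ι → ℝ) :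
    κ ^ 2 * ((M⁻¹ *ᵥ w) ⬝ᵥ (M⁻¹ *ᵥ w)) ≤ w ⬝ᵥ w ∧ 0 ≤ w ⬝ᵥ (M⁻¹ *ᵥ w) ∧
      κ * (w ⬝ᵥ (M⁻¹ *ᵥ w)) ≤ w ⬝ᵥ w := by
  have hu := isUnit_det_of_coercive hκ hM
  have h1 := hM (M⁻¹ *ᵥ w)
  rw [Matrix.mulVec_mulVec, Matrix.mul_nonsing_inv _ hu, Matrix.one_mulVec,
    dotProduct_comm _ w] at h1
  have h2 := two_mul_mul_dotProduct_le κ w (M⁻¹ *ᵥ w)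
  have h3 := dotProduct_self_nonneg_real (M⁻¹ *ᵥ w)
  have h4 := mul_le_mul_of_nonneg_left h1 hκ.le
  refine ⟨by nlinarith, (mul_nonneg hκ.le h3).trans h1, by nlinarith⟩

/-- The resolvent identity: with `a = S⁻¹ w` and `b = Sg⁻¹ w`, the difference of the forms is `b ·
(Sg - S) a`, and both `|a|` and `|b|` are at most `2 |w| / c`. -/
theorem abs_inv_form_sub_inv_form_le (hK : Fintype.card ι ≤ K) (hδ : 0 ≤ δ) (hc : 0 < c)
    (hclose : ∀ j k, |S j k - Sg j k| ≤ δ) (hδc : K * δ ≤ c / 2) (hsymm : Sg.IsSymm)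
    (hcoer : ∀ x, c * (x ⬝ᵥ x) ≤ x ⬝ᵥ (Sg *ᵥ x)) (w : ι → ℝ) :
    |w ⬝ᵥ (S⁻¹ *ᵥ w) - w ⬝ᵥ (Sg⁻¹ *ᵥ w)| ≤ δ * K * (4 / c ^ 2) * (w ⬝ᵥ w) := by
  have hS := coercive_of_entrywise_close hK hδ hclose hδc hcoer
  have huS := isUnit_det_of_coercive (half_pos hc) hS
  have huSg := isUnit_det_of_coercive hc hcoer
  obtain ⟨ha, -, -⟩ := mulVec_inv_bounds_of_coercive (half_pos hc) hS w
  obtain ⟨hb, -, -⟩ := mulVec_inv_bounds_of_coercive hc hcoer w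
  set a := S⁻¹ *ᵥ w with ha'
  set b := Sg⁻¹ *ᵥ w with hb'
  have hSa : S *ᵥ a = w := by
    rw [ha', Matrix.mulVec_mulVec, Matrix.mul_nonsing_inv _ huS, Matrix.one_mulVec]
  have hSb : Sg *ᵥ b = w := by
    rw [hb', Matrix.mulVec_mulVec, Matrix.mul_nonsing_inv _ huSg, Matrix.one_mulVec]
  have hwa : w ⬝ᵥ a = b ⬝ᵥ (Sg *ᵥ a) := by
    rw [Matrix.dotProduct_mulVec b, ← Matrix.mulVec_transpose, hsymm.eq, hSb]
  have hwb : w ⬝ᵥ b = b ⬝ᵥ (S *ᵥ a) := by rw [hSa, dotProduct_comm]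
  have h := abs_dotProduct_mulVec_le (D := S - Sg) hK hδ hclose b a
  rw [Matrix.sub_mulVec, dotProduct_sub, ← hwa, ← hwb, abs_sub_comm] at h
  refine h.trans ?_
  have hab : (b ⬝ᵥ b + a ⬝ᵥ a) / 2 ≤ 4 / c ^ 2 * (w ⬝ᵥ w) := by
    rw [div_mul_eq_mul_div, le_div_iff₀ (by positivity)]
    have := dotProduct_self_nonneg_real w
    nlinarith
  calc _ ≤ δ * K * (4 / c ^ 2 * (w ⬝ᵥ w)) := by gcongr
    _ = _ := by ring

/-- Lipschitz constant of the centred and scaled quadratic form in the perturbation. -/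
noncomputable def formLipschitz (K : ℕ) (c : ℝ) : ℝ :=
  16 * K * (K + 1) / c ^ 2 + (K + 1 / c ^ 2) + K / c

theorem formLipschitz_nonneg {c : ℝ} (hc : 0 < c) (K : ℕ) : 0 ≤ formLipschitz K c := by
  unfold formLipschitz; positivity

/-- The matrix is changed first, at the vector `x - v`, and then the vector, at the matrix `Sg`. The
three summands of `formLipschitz` come from the change of matrix, the cross term in `v` and `x`, and
the term quadratic in `v`. The weight is `1 + |x|²` since the shift matters even at `x = 0`. -/
theorem inv_form_shift_bounds (hK : Fintype.card ι ≤ K) (hc : 0 < c) {ρ : ℝ} (hρ0 : 0 ≤ ρ)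
    (hρ1 : ρ ≤ 1) (hρc : 4 * K * ρ ≤ c) (hclose : ∀ j k, |S j k - Sg j k| ≤ 2 * ρ)
    (hsymm : Sg.IsSymm) (hcoer : ∀ x, c * (x ⬝ᵥ x) ≤ x ⬝ᵥ (Sg *ᵥ x)) {v : ι → ℝ}
    (hv : ∀ j, |v j| ≤ ρ) (x : ι → ℝ) :
    |(x - v) ⬝ᵥ (S⁻¹ *ᵥ (x - v)) - x ⬝ᵥ (Sg⁻¹ *ᵥ x)| ≤
        formLipschitz K c * ρ * (1 + x ⬝ᵥ x) ∧
      0 ≤ (x - v) ⬝ᵥ (S⁻¹ *ᵥ (x - v)) ∧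
      (x - v) ⬝ᵥ (S⁻¹ *ᵥ (x - v)) ≤ 4 * (K + 1) / c * (1 + x ⬝ᵥ x) := by
  have hh := dotProduct_self_nonneg_real x
  have hvv := dotProduct_self_le_of_abs_le hK hv
  have hK0 : (0 : ℝ) ≤ K := Nat.cast_nonneg _
  have hρ2 : ρ ^ 2 ≤ ρ := by nlinarith
  have hw : (x - v) ⬝ᵥ (x - v) ≤ 2 * (K + 1) * (1 + x ⬝ᵥ x) := by
    have h1 := two_mul_mul_dotProduct_le (-1) x v
    have h2 : (x - v) ⬝ᵥ (x - v) = x ⬝ᵥ x - 2 * (x ⬝ᵥ v) + v ⬝ᵥ v := by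
      simp only [sub_dotProduct, dotProduct_sub, dotProduct_comm v x]; ring
    have h3 : (K : ℝ) * ρ ^ 2 ≤ K * 1 := by gcongr; linarith
    have h4 : (0 : ℝ) ≤ K * (x ⬝ᵥ x) := by positivity
    nlinarith
  have hδc : (K : ℝ) * (2 * ρ) ≤ c / 2 := by linarith
  have hS := coercive_of_entrywise_close hK (by positivity) hclose hδc hcoer
  obtain ⟨-, hq0, hq1⟩ := mulVec_inv_bounds_of_coercive (half_pos hc) hS (x - v)
  have h1 := abs_inv_form_sub_inv_form_le hK (by positivity) hc hclose hδc hsymm hcoer (x - v)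
  refine ⟨?_, hq0, ?_⟩
  · obtain ⟨hb, -, -⟩ := mulVec_inv_bounds_of_coercive hc hcoer x
    obtain ⟨-, hv0, hv1⟩ := mulVec_inv_bounds_of_coercive hc hcoer v
    have h2 := abs_dotProduct_le hK hρ0 hv (Sg⁻¹ *ᵥ x)
    have hinv : (Sg⁻¹)ᵀ = Sg⁻¹ := by rw [Matrix.transpose_nonsing_inv, hsymm.eq]
    have hxv : x ⬝ᵥ (Sg⁻¹ *ᵥ v) = v ⬝ᵥ (Sg⁻¹ *ᵥ x) := by
      rw [Matrix.dotProduct_mulVec, ← Matrix.mulVec_transpose, hinv, dotProduct_comm]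
    have h3 : (x - v) ⬝ᵥ (Sg⁻¹ *ᵥ (x - v)) - x ⬝ᵥ (Sg⁻¹ *ᵥ x) =
        -2 * (v ⬝ᵥ (Sg⁻¹ *ᵥ x)) + v ⬝ᵥ (Sg⁻¹ *ᵥ v) := by
      simp only [Matrix.mulVec_sub, sub_dotProduct, dotProduct_sub, hxv]; ring
    have hb' : (Sg⁻¹ *ᵥ x) ⬝ᵥ (Sg⁻¹ *ᵥ x) ≤ 1 / c ^ 2 * (x ⬝ᵥ x) := by
      rw [one_div, inv_mul_eq_div, le_div_iff₀ (by positivity)]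
      linarith
    have hv' : v ⬝ᵥ (Sg⁻¹ *ᵥ v) ≤ K / c * ρ := by
      rw [div_mul_eq_mul_div, le_div_iff₀ hc]
      have : (K : ℝ) * ρ ^ 2 ≤ K * ρ := by gcongr
      linarith
    have h4 : |-2 * (v ⬝ᵥ (Sg⁻¹ *ᵥ x)) + v ⬝ᵥ (Sg⁻¹ *ᵥ v)| ≤
        ρ * (K + 1 / c ^ 2 * (x ⬝ᵥ x)) + K / c * ρ := by
      refine (abs_add_le _ _).trans ?_
      rw [abs_mul, abs_neg, abs_two, abs_of_nonneg hv0]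
      have : ρ * ((K + (Sg⁻¹ *ᵥ x) ⬝ᵥ (Sg⁻¹ *ᵥ x)) / 2) ≤
        ρ * ((K + 1 / c ^ 2 * (x ⬝ᵥ x)) / 2) := by gcongr
      linarith
    have h5 : 2 * ρ * K * (4 / c ^ 2) * ((x - v) ⬝ᵥ (x - v)) ≤
        2 * ρ * K * (4 / c ^ 2) * (2 * (K + 1) * (1 + x ⬝ᵥ x)) := by gcongr
    have h6 : ρ * (K + 1 / c ^ 2 * (x ⬝ᵥ x)) + K / c * ρ ≤
        ((K + 1 / c ^ 2) + K / c) * ρ * (1 + x ⬝ᵥ x) := by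
      have e1 : 0 ≤ ρ * K * (x ⬝ᵥ x) := by positivity
      have e2 : 0 ≤ ρ * (1 / c ^ 2) := by positivity
      have e3 : 0 ≤ K / c * ρ * (x ⬝ᵥ x) := by positivity
      nlinarith
    have h7 : (x - v) ⬝ᵥ (S⁻¹ *ᵥ (x - v)) - x ⬝ᵥ (Sg⁻¹ *ᵥ x) =
        ((x - v) ⬝ᵥ (S⁻¹ *ᵥ (x - v)) - (x - v) ⬝ᵥ (Sg⁻¹ *ᵥ (x - v))) +
        (-2 * (v ⬝ᵥ (Sg⁻¹ *ᵥ x)) + v ⬝ᵥ (Sg⁻¹ *ᵥ v)) := by rw [← h3]; ring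
    rw [h7]
    refine (abs_add_le _ _).trans ((add_le_add (h1.trans h5) (h4.trans h6)).trans (le_of_eq ?_))
    unfold formLipschitz
    ring
  · rw [div_mul_eq_mul_div, le_div_iff₀ hc]
    nlinarith

end Perturbation

/-! ### Deterministic bound for the plug-in error -/

section PlugIn

variable {ι : Type*} {n : ℕ}

/-- The coordinatewise average. -/
noncomputable def average (x : Fin n → ι → ℝ) : ι → ℝ := fun j => (n : ℝ)⁻¹ * ∑ i, x i j

/-- The sample covariance matrix of the columns. -/
noncomputable def columnCov (x : Fin n → ι → ℝ) : Matrix ι ι ℝ :=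
  Matrix.of fun j k => (n : ℝ)⁻¹ * ∑ i, (x i j - average x j) * (x i k - average x k)

theorem columnCov_apply_eq (hn : 0 < n) (x : Fin n → ι → ℝ) (j k : ι) :
    columnCov x j k = (n : ℝ)⁻¹ * (∑ i, x i j * x i k) - average x j * average x k := by
  have hn' : (n : ℝ) ≠ 0 := by exact_mod_cast hn.ne'
  have hj : ∑ i, x i j = n * average x j := by simp [average, hn']
  have hk : ∑ i, x i k = n * average x k := by simp [average, hn']
  have h : ∀ i, (x i j - average x j) * (x i k - average x k) =
      x i j * x i k - average x k * x i j - average x j * x i k + average x j * average x k :=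
    fun i => by ring
  simp only [columnCov, Matrix.of_apply]
  simp_rw [h]
  rw [Finset.sum_add_distrib, Finset.sum_sub_distrib, Finset.sum_sub_distrib, ← Finset.mul_sum,
    ← Finset.mul_sum, hj, hk]
  simp only [Finset.sum_const, Finset.card_univ, Fintype.card_fin, nsmul_eq_mul]
  field_simp
  ring

variable [Fintype ι]

theorem dotProduct_columnCov_mulVec (x : Fin n → ι → ℝ) (a b : ι → ℝ) :
    a ⬝ᵥ (columnCov x *ᵥ b) =
      (n : ℝ)⁻¹ * ∑ i, (a ⬝ᵥ (x i - average x)) * ((x i - average x) ⬝ᵥ b) := by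
  simp only [dotProduct, Matrix.mulVec, columnCov, Matrix.of_apply, Pi.sub_apply, Finset.mul_sum,
    Finset.sum_mul]
  rw [Finset.sum_congr rfl fun j _ => Finset.sum_comm, Finset.sum_comm]
  refine Finset.sum_congr rfl fun i _ => ?_
  rw [Finset.sum_comm]
  refine Finset.sum_congr rfl fun j _ => Finset.sum_congr rfl fun k _ => by ring

/-- The squared deviation of the first two sample moments from `0` and `Sg`. -/
noncomputable def momentDeviation (x : Fin n → ι → ℝ) (Sg : Matrix ι ι ℝ) : ℝ :=
  ∑ j, ∑ k, ((n : ℝ)⁻¹ * ∑ i, (x i j * x i k - Sg j k)) ^ 2 + ∑ j, average x j ^ 2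

/-- An envelope for the average of the `m`-th powers of the quadratic forms. -/
noncomputable def normEnvelope (m : ℕ) (x : Fin n → ι → ℝ) : ℝ :=
  (n : ℝ)⁻¹ * ∑ i, (1 + x i ⬝ᵥ x i) ^ m

/-- The radius in which the plug-in perturbation is controlled. -/
noncomputable def goodRadius (K : ℕ) (c : ℝ) : ℝ := min 1 (c / (4 * K))

/-- The coefficient of the linear term in the plug-in error. -/
noncomputable def linearErrorConst (m K : ℕ) (c : ℝ) : ℝ :=
  formLipschitz K c * m * (4 * (K + 1) / c) ^ (m - 1) + (1 / c) ^ m / goodRadius K c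

/-- The coefficient of the term in the plug-in error that controls ill-conditioned samples. -/
noncomputable def tailErrorConst (m K : ℕ) (c : ℝ) : ℝ := (K / goodRadius K c ^ 2) ^ m

theorem goodRadius_pos {K : ℕ} {c : ℝ} (hK : 0 < K) (hc : 0 < c) : 0 < goodRadius K c := by
  have : (0 : ℝ) < K := by exact_mod_cast hK
  exact lt_min one_pos (by positivity)

theorem momentDeviation_nonneg (x : Fin n → ι → ℝ) (Sg : Matrix ι ι ℝ) :
    0 ≤ momentDeviation x Sg :=
  add_nonneg (Finset.sum_nonneg fun _ _ => Finset.sum_nonneg fun _ _ => sq_nonneg _)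
    (Finset.sum_nonneg fun _ _ => sq_nonneg _)

theorem abs_average_le (x : Fin n → ι → ℝ) (Sg : Matrix ι ι ℝ) (j : ι) :
    |average x j| ≤ √(momentDeviation x Sg) := by
  refine Real.abs_le_sqrt ?_
  have h1 := Finset.single_le_sum (f := fun j => average x j ^ 2)
    (fun j _ => sq_nonneg _) (Finset.mem_univ j)
  have h2 : 0 ≤ ∑ j, ∑ k, ((n : ℝ)⁻¹ * ∑ i, (x i j * x i k - Sg j k)) ^ 2 :=
    Finset.sum_nonneg fun j _ => Finset.sum_nonneg fun k _ => sq_nonneg _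
  unfold momentDeviation
  linarith

theorem abs_average_mul_sub_le (x : Fin n → ι → ℝ) (Sg : Matrix ι ι ℝ) (j k : ι) :
    |(n : ℝ)⁻¹ * ∑ i, (x i j * x i k - Sg j k)| ≤ √(momentDeviation x Sg) := by
  refine Real.abs_le_sqrt ?_
  have h1 := Finset.single_le_sum
    (f := fun k => ((n : ℝ)⁻¹ * ∑ i, (x i j * x i k - Sg j k)) ^ 2)
    (fun j _ => sq_nonneg _) (Finset.mem_univ k)
  have h2 := Finset.single_le_sum
    (f := fun j => ∑ k, ((n : ℝ)⁻¹ * ∑ i, (x i j * x i k - Sg j k)) ^ 2)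
    (fun j _ => Finset.sum_nonneg fun k _ => sq_nonneg _) (Finset.mem_univ j)
  have h3 : 0 ≤ ∑ j, average x j ^ 2 := Finset.sum_nonneg fun j _ => sq_nonneg _
  unfold momentDeviation
  beta_reduce at h1 h2
  linarith

theorem abs_columnCov_sub_le (hn : 0 < n) (x : Fin n → ι → ℝ) (Sg : Matrix ι ι ℝ)
    (h1 : √(momentDeviation x Sg) ≤ 1) (j k : ι) :
    |columnCov x j k - Sg j k| ≤ 2 * √(momentDeviation x Sg) := by
  have hn' : (n : ℝ) ≠ 0 := by exact_mod_cast hn.ne'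
  have h2 : columnCov x j k - Sg j k =
      (n : ℝ)⁻¹ * (∑ i, (x i j * x i k - Sg j k)) - average x j * average x k := by
    rw [columnCov_apply_eq hn, Finset.sum_sub_distrib, mul_sub]
    simp only [Finset.sum_const, Finset.card_univ, Fintype.card_fin, nsmul_eq_mul]
    rw [inv_mul_cancel_left₀ hn']
    ring
  rw [h2]
  refine (abs_sub _ _).trans ?_
  rw [abs_mul (average x j)]
  -- The product of averages is of second order; here `√R ≤ 1` makes it at most `√R`, hence the
  -- factor `2`.
  have h3 : |average x j| * |average x k| ≤ 1 * √(momentDeviation x Sg) :=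
    mul_le_mul ((abs_average_le x Sg j).trans h1) (abs_average_le x Sg k) (abs_nonneg _)
      zero_le_one
  linarith [abs_average_mul_sub_le x Sg j k]

variable [DecidableEq ι]

/-- With `a = S⁻¹ w` the form equals `a · S a`, which is an average of squares. -/
theorem inv_form_columnCov_nonneg {x : Fin n → ι → ℝ} (hu : IsUnit (columnCov x).det)
    (w : ι → ℝ) : 0 ≤ w ⬝ᵥ ((columnCov x)⁻¹ *ᵥ w) := by
  have hw : columnCov x *ᵥ ((columnCov x)⁻¹ *ᵥ w) = w := by
    rw [Matrix.mulVec_mulVec, Matrix.mul_nonsing_inv _ hu, Matrix.one_mulVec]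
  have h := dotProduct_columnCov_mulVec x ((columnCov x)⁻¹ *ᵥ w) ((columnCov x)⁻¹ *ᵥ w)
  rw [hw, dotProduct_comm] at h
  rw [h]
  refine mul_nonneg (by positivity) (Finset.sum_nonneg fun i _ => ?_)
  rw [dotProduct_comm]
  exact mul_self_nonneg _

/-- The leverages of a sample add up to `n` times the dimension. -/
theorem sum_inv_form_columnCov (hn : 0 < n) {x : Fin n → ι → ℝ}
    (hu : IsUnit (columnCov x).det) :
    ∑ i, (x i - average x) ⬝ᵥ ((columnCov x)⁻¹ *ᵥ (x i - average x)) = n * Fintype.card ι := by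
  have hn' : (n : ℝ) ≠ 0 := by exact_mod_cast hn.ne'
  -- The sum of the leverages is `n` times the trace of `S⁻¹ S`.
  have htr : ((columnCov x)⁻¹ * columnCov x).trace = Fintype.card ι := by
    rw [Matrix.nonsing_inv_mul _ hu, Matrix.trace_one]
  rw [← htr]
  simp only [Matrix.trace, Matrix.diag, Matrix.mul_apply, columnCov, Matrix.of_apply, dotProduct,
    Matrix.mulVec, Pi.sub_apply, Finset.mul_sum]
  rw [Finset.sum_comm]
  refine Finset.sum_congr rfl fun j _ => ?_
  rw [Finset.sum_comm]
  refine Finset.sum_congr rfl fun k _ => Finset.sum_congr rfl fun i _ => ?_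
  field_simp

/-- The leverages are nonnegative with sum at most `nK`, so each is at most `nK`; bound `m - 1`
factors by this maximum and sum the last one. If the sample covariance is singular, its inverse is
read as `0` and every power vanishes since `m > 0`. No assumption is made on the sample. -/
theorem average_inv_form_columnCov_pow_le (hn : 0 < n) (x : Fin n → ι → ℝ) {m K : ℕ}
    (hm : 0 < m) (hK : Fintype.card ι ≤ K) :
    0 ≤ (n : ℝ)⁻¹ * ∑ i, ((x i - average x) ⬝ᵥ ((columnCov x)⁻¹ *ᵥ (x i - average x))) ^ m ∧
    (n : ℝ)⁻¹ * ∑ i, ((x i - average x) ⬝ᵥ ((columnCov x)⁻¹ *ᵥ (x i - average x))) ^ m ≤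
      (K : ℝ) ^ m * (n : ℝ) ^ (m - 1) := by
  have hn' : (0 : ℝ) < n := by exact_mod_cast hn
  have hK' : (Fintype.card ι : ℝ) ≤ K := by exact_mod_cast hK
  by_cases hu : IsUnit (columnCov x).det
  · set q : Fin n → ℝ := fun i =>
      (x i - average x) ⬝ᵥ ((columnCov x)⁻¹ *ᵥ (x i - average x)) with hq
    have hq0 : ∀ i, 0 ≤ q i := fun i => inv_form_columnCov_nonneg hu _
    have hsum : ∑ i, q i = n * Fintype.card ι := sum_inv_form_columnCov hn hu
    have hle : ∀ i, q i ≤ n * K := fun i =>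
      (Finset.single_le_sum (fun j _ => hq0 j) (Finset.mem_univ i)).trans
        (hsum.le.trans (by gcongr))
    refine ⟨mul_nonneg (by positivity) (Finset.sum_nonneg fun i _ => pow_nonneg (hq0 i) m), ?_⟩
    obtain ⟨k, rfl⟩ : ∃ k, m = k + 1 := ⟨m - 1, by omega⟩
    calc (n : ℝ)⁻¹ * ∑ i, q i ^ (k + 1) ≤ (n : ℝ)⁻¹ * ∑ i, (n * K) ^ k * q i := by
          gcongr with i
          rw [pow_succ]
          exact mul_le_mul_of_nonneg_right (pow_le_pow_left₀ (hq0 i) (hle i) k) (hq0 i)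
      _ = (n * K) ^ k * Fintype.card ι := by
          rw [← Finset.mul_sum, hsum]
          field_simp
      _ ≤ (n * K) ^ k * K := by gcongr
      _ = _ := by
          rw [Nat.add_sub_cancel]
          ring
  · have : ∀ i, ((x i - average x) ⬝ᵥ ((columnCov x)⁻¹ *ᵥ (x i - average x))) ^ m = 0 :=
      fun i => by
        rw [Matrix.nonsing_inv_apply_not_isUnit _ hu]
        simp [hm.ne']
    simp only [this, Finset.sum_const_zero, mul_zero, le_refl, true_and]
    positivity

theorem inv_form_pow_le {Sg : Matrix ι ι ℝ} {c : ℝ} (hc : 0 < c)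
    (hcoer : ∀ x, c * (x ⬝ᵥ x) ≤ x ⬝ᵥ (Sg *ᵥ x)) (m : ℕ) (x : ι → ℝ) :
    0 ≤ x ⬝ᵥ (Sg⁻¹ *ᵥ x) ∧ (x ⬝ᵥ (Sg⁻¹ *ᵥ x)) ^ m ≤ (1 / c) ^ m * (1 + x ⬝ᵥ x) ^ m := by
  obtain ⟨-, h0, h1⟩ := mulVec_inv_bounds_of_coercive hc hcoer x
  refine ⟨h0, ?_⟩
  rw [← mul_pow]
  refine pow_le_pow_left₀ h0 ?_ m
  rw [one_div, inv_mul_eq_div, le_div_iff₀ hc]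
  linarith

/-- Both forms are at most `4(K+1)/c · (1 + |x|²)`, so the difference of `m`-th powers costs `m - 1`
factors of this size. -/
theorem abs_inv_form_shift_pow_sub_le {S Sg : Matrix ι ι ℝ} {m K : ℕ} {c ρ : ℝ} (hm : 0 < m)
    (hK : Fintype.card ι ≤ K) (hc : 0 < c) (hρ0 : 0 ≤ ρ)
    (hρ1 : ρ ≤ 1) (hρc : 4 * K * ρ ≤ c) (hclose : ∀ j k, |S j k - Sg j k| ≤ 2 * ρ)
    (hsymm : Sg.IsSymm) (hcoer : ∀ x, c * (x ⬝ᵥ x) ≤ x ⬝ᵥ (Sg *ᵥ x)) {v : ι → ℝ}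
    (hv : ∀ j, |v j| ≤ ρ) (x : ι → ℝ) :
    |((x - v) ⬝ᵥ (S⁻¹ *ᵥ (x - v))) ^ m - (x ⬝ᵥ (Sg⁻¹ *ᵥ x)) ^ m| ≤
      formLipschitz K c * m * (4 * (K + 1) / c) ^ (m - 1) * ρ * (1 + x ⬝ᵥ x) ^ m := by
  obtain ⟨h1, h2, h3⟩ := inv_form_shift_bounds hK hc hρ0 hρ1 hρc hclose hsymm hcoer hv x
  obtain ⟨-, h4, h5⟩ := mulVec_inv_bounds_of_coercive hc hcoer x
  have hK0 : (0 : ℝ) ≤ K := Nat.cast_nonneg _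
  have hL := formLipschitz_nonneg hc K
  have hxx := dotProduct_self_nonneg_real x
  have h6 : x ⬝ᵥ (Sg⁻¹ *ᵥ x) ≤ 4 * (K + 1) / c * (1 + x ⬝ᵥ x) := by
    rw [div_mul_eq_mul_div, le_div_iff₀ hc]
    nlinarith [mul_nonneg hK0 hxx]
  generalize (x - v) ⬝ᵥ (S⁻¹ *ᵥ (x - v)) = q at h1 h2 h3 ⊢
  generalize x ⬝ᵥ (Sg⁻¹ *ᵥ x) = r at h1 h4 h6 ⊢
  have h7 : max |q| |r| ≤ 4 * (K + 1) / c * (1 + x ⬝ᵥ x) := by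
    rw [abs_of_nonneg h2, abs_of_nonneg h4]
    exact max_le h3 h6
  calc |q ^ m - r ^ m| ≤ |q - r| * m * max |q| |r| ^ (m - 1) := abs_pow_sub_pow_le _ _ _
    _ ≤ (formLipschitz K c * ρ * (1 + x ⬝ᵥ x)) * m *
        (4 * (K + 1) / c * (1 + x ⬝ᵥ x)) ^ (m - 1) := by gcongr
    _ = formLipschitz K c * m * (4 * (K + 1) / c) ^ (m - 1) * ρ *
        ((1 + x ⬝ᵥ x) ^ (m - 1) * (1 + x ⬝ᵥ x)) := by rw [mul_pow]; ring
    _ = _ := by rw [← pow_succ, Nat.sub_add_cancel hm]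

/-- Split according to whether `√R` exceeds `goodRadius`. Below it, the perturbation bound applies
to each observation. Above it, both averages are nonnegative and are bounded separately, the first
by leverages and the second by the envelope, and the powers of `√R / goodRadius > 1` are inserted as
in Chebyshev's inequality. -/
theorem abs_plugIn_sub_le (hn : 0 < n) (x : Fin n → ι → ℝ) {Sg : Matrix ι ι ℝ} {m K : ℕ} {c : ℝ}
    (hm : 0 < m) (hK0 : 0 < K) (hK : Fintype.card ι ≤ K) (hc : 0 < c) (hsymm : Sg.IsSymm)
    (hcoer : ∀ x, c * (x ⬝ᵥ x) ≤ x ⬝ᵥ (Sg *ᵥ x)) :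
    |(n : ℝ)⁻¹ * ∑ i, ((x i - average x) ⬝ᵥ ((columnCov x)⁻¹ *ᵥ (x i - average x))) ^ m -
        (n : ℝ)⁻¹ * ∑ i, (x i ⬝ᵥ (Sg⁻¹ *ᵥ x i)) ^ m| ≤
      linearErrorConst m K c * (√(momentDeviation x Sg) * normEnvelope m x) +
        tailErrorConst m K c * ((n : ℝ) ^ (m - 1) * momentDeviation x Sg ^ m) := by
  have hn' : (0 : ℝ) < n := by exact_mod_cast hn
  have hK' : (0 : ℝ) < K := by exact_mod_cast hK0
  have hη := goodRadius_pos hK0 hc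
  have hR := momentDeviation_nonneg x Sg
  have hL := formLipschitz_nonneg hc K
  have hH : 0 ≤ normEnvelope m x := mul_nonneg (by positivity) (Finset.sum_nonneg fun i _ =>
    pow_nonneg (by linarith [dotProduct_self_nonneg_real (x i)]) m)
  set R := momentDeviation x Sg with hRdef
  set η := goodRadius K c with hηdef
  set ρ := √R with hρdef
  have hρ0 : 0 ≤ ρ := Real.sqrt_nonneg _
  rcases le_or_gt ρ η with hρ | hρ
  · have hρ1 : ρ ≤ 1 := hρ.trans (min_le_left _ _)
    have hρc : 4 * K * ρ ≤ c := by
      have := hρ.trans (min_le_right _ _)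
      rw [le_div_iff₀ (by positivity)] at this
      linarith
    have hterm := fun i => abs_inv_form_shift_pow_sub_le hm hK hc hρ0 hρ1 hρc
      (abs_columnCov_sub_le hn x Sg hρ1) hsymm hcoer (abs_average_le x Sg) (x i)
    rw [← mul_sub, ← Finset.sum_sub_distrib, abs_mul, abs_of_nonneg (by positivity)]
    have h1 : (n : ℝ)⁻¹ * |∑ i, (((x i - average x) ⬝ᵥ ((columnCov x)⁻¹ *ᵥ (x i - average x))) ^ m -
        (x i ⬝ᵥ (Sg⁻¹ *ᵥ x i)) ^ m)| ≤
        formLipschitz K c * m * (4 * (K + 1) / c) ^ (m - 1) * (ρ * normEnvelope m x) := by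
      calc _ ≤ (n : ℝ)⁻¹ * ∑ i, formLipschitz K c * m * (4 * (K + 1) / c) ^ (m - 1) * ρ *
            (1 + x i ⬝ᵥ x i) ^ m := by
            gcongr
            exact (Finset.abs_sum_le_sum_abs _ _).trans (Finset.sum_le_sum fun i _ => hterm i)
        _ = _ := by
            rw [← Finset.mul_sum, normEnvelope]
            ring
    refine h1.trans ?_
    have h2 : 0 ≤ (1 / c) ^ m / η * (ρ * normEnvelope m x) := by positivity
    have h3 : 0 ≤ tailErrorConst m K c * ((n : ℝ) ^ (m - 1) * R ^ m) := by
      unfold tailErrorConst; positivity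
    rw [linearErrorConst, add_mul]
    linarith
  · obtain ⟨hT0, hT⟩ := average_inv_form_columnCov_pow_le hn x hm hK
    have hp0 : 0 ≤ (n : ℝ)⁻¹ * ∑ i, (x i ⬝ᵥ (Sg⁻¹ *ᵥ x i)) ^ m :=
      mul_nonneg (by positivity)
        (Finset.sum_nonneg fun i _ => pow_nonneg (inv_form_pow_le hc hcoer m (x i)).1 m)
    have hp1 : (n : ℝ)⁻¹ * ∑ i, (x i ⬝ᵥ (Sg⁻¹ *ᵥ x i)) ^ m ≤ (1 / c) ^ m * normEnvelope m x := by
      calc _ ≤ (n : ℝ)⁻¹ * ∑ i, (1 / c) ^ m * (1 + x i ⬝ᵥ x i) ^ m := by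
            gcongr with i
            exact (inv_form_pow_le hc hcoer m (x i)).2
        _ = _ := by
            rw [← Finset.mul_sum, normEnvelope]
            ring
    have h1 : (1 / c) ^ m * normEnvelope m x ≤ (1 / c) ^ m / η * (ρ * normEnvelope m x) := by
      calc _ = (1 / c) ^ m / η * (η * normEnvelope m x) := by field_simp
        _ ≤ _ := by gcongr
    have h2 : (K : ℝ) ^ m * (n : ℝ) ^ (m - 1) ≤
        tailErrorConst m K c * ((n : ℝ) ^ (m - 1) * R ^ m) := by
      have hηR : η ^ 2 ≤ R := by
        rw [← Real.sq_sqrt hR]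
        exact pow_le_pow_left₀ hη.le hρ.le 2
      calc _ = (K / η ^ 2) ^ m * ((n : ℝ) ^ (m - 1) * (η ^ 2) ^ m) := by
            rw [div_pow]
            field_simp
        _ ≤ _ := by
            unfold tailErrorConst
            gcongr
    have h3 : 0 ≤ formLipschitz K c * m * (4 * (K + 1) / c) ^ (m - 1) * (ρ * normEnvelope m x) := by
      positivity
    rw [linearErrorConst, add_mul]
    rw [abs_le]
    constructor <;> linarith

end PlugIn

/-! ### Moment bounds for the ingredients of the error -/

section ErrorMoments

variable {Ω : Type*} [MeasurableSpace Ω] {P : Measure Ω} [IsProbabilityMeasure P] {n : ℕ}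

theorem sum_pow_le_pow_mul_sum_pow {κ : Type*} [Fintype κ] {N : ℕ} (hN : Fintype.card κ ≤ N)
    {a : κ → ℝ} (ha : ∀ i, 0 ≤ a i) {r : ℕ} (hr : 0 < r) :
    (∑ i, a i) ^ r ≤ (N : ℝ) ^ (r - 1) * ∑ i, a i ^ r := by
  obtain ⟨k, rfl⟩ : ∃ k, r = k + 1 := ⟨r - 1, by omega⟩
  have hN' : (Fintype.card κ : ℝ) ≤ N := by exact_mod_cast hN
  refine (pow_sum_le_card_mul_sum_pow (fun i _ => ha i) k).trans ?_
  rw [Nat.add_sub_cancel, Finset.card_univ]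
  have : 0 ≤ ∑ i, a i ^ (k + 1) := Finset.sum_nonneg fun i _ => pow_nonneg (ha i) _
  gcongr

/-- The power mean inequality reduces to the even moments of single averages; independence is
required only within each family `X a`, not across `a`. -/
theorem integral_sum_sq_average_pow_le {κ : Type*} [Fintype κ] {N : ℕ}
    (hN : Fintype.card κ ≤ N) (hn : 0 < n) {X : κ → Fin n → Ω → ℝ}
    (hL : ∀ a i, HasAllMoments (X a i) P) (hind : ∀ a, iIndepFun (X a) P)
    (hmean : ∀ a i, ∫ ω, X a i ω ∂P = 0) {B : ℝ} (hB0 : 0 ≤ B) {r : ℕ} (hr : 0 < r)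
    (hB : ∀ a i, ∀ q ≤ r, ∫ ω, X a i ω ^ (2 * q) ∂P ≤ B) :
    ∫ ω, (∑ a, ((n : ℝ)⁻¹ * ∑ i, X a i ω) ^ 2) ^ r ∂P ≤
      (N : ℝ) ^ r * evenMomentConst B r / (n : ℝ) ^ r := by
  have hN' : (Fintype.card κ : ℝ) ≤ N := by exact_mod_cast hN
  have hz : ∀ a, HasAllMoments (fun ω => (n : ℝ)⁻¹ * ∑ i, X a i ω) P := fun a =>
    (HasAllMoments.sum _ fun i _ => hL a i).const_mul _
  have hc := evenMomentConst_nonneg hB0 r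
  calc _ ≤ ∫ ω, (N : ℝ) ^ (r - 1) * ∑ a, ((n : ℝ)⁻¹ * ∑ i, X a i ω) ^ (2 * r) ∂P := by
        refine integral_mono ?_ ?_ fun ω => ?_
        · exact ((HasAllMoments.sum _ fun a _ => (hz a).pow 2).pow r).integrable
        · exact ((HasAllMoments.sum _ fun a _ => (hz a).pow (2 * r)).const_mul _).integrable
        · simp only [pow_mul]
          exact sum_pow_le_pow_mul_sum_pow hN (fun a => sq_nonneg _) hr
    _ ≤ (N : ℝ) ^ (r - 1) * ∑ _a : κ, evenMomentConst B r / (n : ℝ) ^ r := by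
        rw [integral_const_mul, integral_finsetSum _ fun a _ => ((hz a).pow (2 * r)).integrable]
        gcongr with a
        exact integral_average_pow_even_le hn (hL a) (hind a) (hmean a) hB0 (hB a)
    _ = (N : ℝ) ^ (r - 1) * Fintype.card κ * (evenMomentConst B r / (n : ℝ) ^ r) := by
        simp only [Finset.sum_const, Finset.card_univ, nsmul_eq_mul]
        ring
    _ ≤ (N : ℝ) ^ (r - 1) * N * (evenMomentConst B r / (n : ℝ) ^ r) := by gcongr
    _ = _ := by
        rw [← pow_succ, Nat.sub_add_cancel hr]
        ring

theorem one_add_sum_sq_pow_le {ι : Type*} [Fintype ι] {K : ℕ} (hK : Fintype.card ι ≤ K)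
    (x : ι → ℝ) {q : ℕ} (hq : 0 < q) :
    (1 + x ⬝ᵥ x) ^ q ≤ 2 ^ q * (1 + (K : ℝ) ^ (q - 1) * ∑ j, x j ^ (2 * q)) := by
  have hx := dotProduct_self_nonneg_real x
  have h1 := add_pow_le zero_le_one hx q
  have h2 : (x ⬝ᵥ x) ^ q ≤ (K : ℝ) ^ (q - 1) * ∑ j, x j ^ (2 * q) := by
    simp only [dotProduct, ← sq, pow_mul]
    exact sum_pow_le_pow_mul_sum_pow hK (fun j => sq_nonneg _) hq
  have h3 : (2 : ℝ) ^ (q - 1) ≤ 2 ^ q := pow_le_pow_right₀ one_le_two (Nat.sub_le _ _)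
  rw [one_pow] at h1
  have h4 : 0 ≤ (x ⬝ᵥ x) ^ q := pow_nonneg hx q
  calc _ ≤ _ := h1
    _ ≤ 2 ^ q * (1 + (x ⬝ᵥ x) ^ q) := by gcongr
    _ ≤ _ := by gcongr

/-- A bound on the `q`-th moment of `1 + |x|²` from bounds `b` on the even coordinate moments. -/
noncomputable def envelopeBound (b : ℕ → ℝ) (K q : ℕ) : ℝ := 2 ^ q * (1 + (K : ℝ) ^ q * b q)

theorem integral_one_add_sum_sq_pow_le {ι : Type*} [Fintype ι] {K : ℕ}
    (hK : Fintype.card ι ≤ K) {x : Ω → ι → ℝ} {b : ℕ → ℝ}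
    (hL : ∀ j, HasAllMoments (fun ω => x ω j) P) {q : ℕ} (hq : 0 < q) (hb0 : 0 ≤ b q)
    (hb : ∀ j, ∫ ω, x ω j ^ (2 * q) ∂P ≤ b q) :
    ∫ ω, (1 + x ω ⬝ᵥ x ω) ^ q ∂P ≤ envelopeBound b K q := by
  have hK' : (Fintype.card ι : ℝ) ≤ K := by exact_mod_cast hK
  have hS : HasAllMoments (fun ω => ∑ j, x ω j ^ (2 * q)) P :=
    HasAllMoments.sum _ fun j _ => (hL j).pow _
  calc _ ≤ ∫ ω, 2 ^ q * (1 + (K : ℝ) ^ (q - 1) * ∑ j, x ω j ^ (2 * q)) ∂P := by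
        refine integral_mono ?_ ?_ fun ω => one_add_sum_sq_pow_le hK _ hq
        · exact (((HasAllMoments.const 1).add
            (HasAllMoments.sum _ fun j _ => (hL j).mul (hL j))).pow q).integrable
        · exact (((HasAllMoments.const 1).add (hS.const_mul _)).const_mul _).integrable
    _ = 2 ^ q * (1 + (K : ℝ) ^ (q - 1) * ∑ j, ∫ ω, x ω j ^ (2 * q) ∂P) := by
        rw [integral_const_mul, integral_add (integrable_const _) (hS.const_mul _).integrable,
          integral_const_mul, integral_finsetSum _ fun j _ => ((hL j).pow (2 * q)).integrable]
        simp
    _ ≤ 2 ^ q * (1 + (K : ℝ) ^ (q - 1) * ∑ _j : ι, b q) := by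
        gcongr with j
        exact hb j
    _ ≤ 2 ^ q * (1 + (K : ℝ) ^ (q - 1) * (K * b q)) := by
        simp only [Finset.sum_const, Finset.card_univ, nsmul_eq_mul]
        gcongr
    _ = _ := by
        rw [envelopeBound, ← mul_assoc, ← pow_succ, Nat.sub_add_cancel hq]

/-- By the inequality of arithmetic and geometric means, the power `2q` of a product is controlled
by powers `4q` of the factors, and the mean of the product by the second moments. -/
theorem integral_mul_sub_pow_even_le {X Y : Ω → ℝ} (hX : HasAllMoments X P)
    (hY : HasAllMoments Y P) {b : ℕ → ℝ} (hbX : ∀ r, ∫ ω, X ω ^ (2 * r) ∂P ≤ b r)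
    (hbY : ∀ r, ∫ ω, Y ω ^ (2 * r) ∂P ≤ b r) (q : ℕ) :
    ∫ ω, (X ω * Y ω - ∫ ω', X ω' * Y ω' ∂P) ^ (2 * q) ∂P ≤ 4 ^ q * (b (2 * q) + b 1 ^ (2 * q)) := by
  set s := ∫ ω', X ω' * Y ω' ∂P with hs
  have hs1 : |s| ≤ b 1 := by
    calc |s| ≤ ∫ ω, |X ω * Y ω| ∂P := abs_integral_le_integral_abs
      _ ≤ ∫ ω, 2⁻¹ * (X ω ^ 2 + Y ω ^ 2) ∂P := by
          refine integral_mono (hX.mul hY).integrable.abs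
            (((hX.pow 2).add (hY.pow 2)).const_mul _).integrable fun ω => ?_
          simp only [abs_mul]
          nlinarith [sq_nonneg (|X ω| - |Y ω|), sq_abs (X ω), sq_abs (Y ω)]
      _ ≤ b 1 := by
          rw [integral_const_mul, integral_add (hX.pow 2).integrable (hY.pow 2).integrable]
          have h1 := hbX 1
          have h2 := hbY 1
          rw [mul_one] at h1 h2
          linarith
  have hpt : ∀ x y : ℝ, (x * y - s) ^ (2 * q) ≤
      4 ^ q * (2⁻¹ * (x ^ (2 * (2 * q)) + y ^ (2 * (2 * q))) + b 1 ^ (2 * q)) := fun x y => by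
    have h1 : (x * y - s) ^ (2 * q) ≤ (|x * y| + |s|) ^ (2 * q) := by
      rw [pow_mul, pow_mul, ← sq_abs]
      gcongr
      exact abs_sub _ _
    have h2 := add_pow_le (abs_nonneg (x * y)) (abs_nonneg s) (2 * q)
    have h3 : (2 : ℝ) ^ (2 * q - 1) ≤ 4 ^ q := by
      rw [show (4 : ℝ) = 2 ^ 2 by norm_num, ← pow_mul]
      exact pow_le_pow_right₀ one_le_two (Nat.sub_le _ _)
    have h4 : |x * y| ^ (2 * q) ≤ 2⁻¹ * (x ^ (2 * (2 * q)) + y ^ (2 * (2 * q))) := by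
      have e : ∀ z : ℝ, z ^ (2 * (2 * q)) = (z ^ (2 * q)) ^ 2 := fun z => by ring
      rw [pow_mul, sq_abs, ← pow_mul, mul_pow, e, e]
      nlinarith [sq_nonneg (x ^ (2 * q) - y ^ (2 * q))]
    have h5 : |s| ^ (2 * q) ≤ b 1 ^ (2 * q) := pow_le_pow_left₀ (abs_nonneg _) hs1 _
    calc _ ≤ _ := h1.trans h2
      _ ≤ 4 ^ q * (|x * y| ^ (2 * q) + |s| ^ (2 * q)) := by gcongr
      _ ≤ _ := by gcongr
  have hXY := (hX.pow (2 * (2 * q))).add (hY.pow (2 * (2 * q)))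
  calc _ ≤ ∫ ω, 4 ^ q * (2⁻¹ * (X ω ^ (2 * (2 * q)) + Y ω ^ (2 * (2 * q))) + b 1 ^ (2 * q)) ∂P :=
        integral_mono (((hX.mul hY).sub (HasAllMoments.const s)).pow _).integrable
          (((hXY.const_mul _).add (HasAllMoments.const _)).const_mul _).integrable
          fun ω => hpt _ _
    _ = 4 ^ q * (2⁻¹ * (∫ ω, X ω ^ (2 * (2 * q)) ∂P + ∫ ω, Y ω ^ (2 * (2 * q)) ∂P) +
          b 1 ^ (2 * q)) := by
        rw [integral_const_mul, integral_add (hXY.const_mul _).integrable (integrable_const _),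
          integral_const_mul, integral_add (hX.pow _).integrable (hY.pow _).integrable]
        simp
    _ ≤ _ := by
        gcongr
        linarith [hbX (2 * q), hbY (2 * q)]

end ErrorMoments

/-! ### Expected plug-in error of one block -/

section PlugInError

/-- A common bound for the even moments of all averages in the plug-in error. -/
noncomputable def commonMomentBound (m K : ℕ) (c : ℝ) (b : ℕ → ℝ) : ℝ :=
  1 + (1 / c) ^ (2 * m) * envelopeBound b K (2 * m) +
    ∑ q ∈ Finset.range (m + 1), (b q + 4 ^ q * (b (2 * q) + b 1 ^ (2 * q)))

/-- The constant in the `L¹` bound for the plug-in error. -/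
noncomputable def plugInErrorConst (m K : ℕ) (c : ℝ) (b : ℕ → ℝ) : ℝ :=
  (evenMomentConst (commonMomentBound m K c b) 1 + 1) / 2 +
    linearErrorConst m K c * (((K ^ 2 + K : ℕ) : ℝ) ^ 1 *
      evenMomentConst (commonMomentBound m K c b) 1 + envelopeBound b K (2 * m)) / 2 +
    tailErrorConst m K c * (((K ^ 2 + K : ℕ) : ℝ) ^ m *
      evenMomentConst (commonMomentBound m K c b) m)

section Constants

variable {m K : ℕ} {c : ℝ} {b : ℕ → ℝ}

theorem envelopeBound_nonneg (hb0 : ∀ r, 0 ≤ b r) (q : ℕ) : 0 ≤ envelopeBound b K q := by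
  have := hb0 q
  unfold envelopeBound
  positivity

theorem commonMomentBound_summand_nonneg (hb0 : ∀ r, 0 ≤ b r) (q : ℕ) :
    0 ≤ b q + 4 ^ q * (b (2 * q) + b 1 ^ (2 * q)) := by
  have h1 := hb0 1
  have h2 := hb0 q
  have h3 := hb0 (2 * q)
  positivity

theorem le_commonMomentBound (hc : 0 < c) (hb0 : ∀ r, 0 ≤ b r) {q : ℕ} (hq : q ≤ m) :
    b q + 4 ^ q * (b (2 * q) + b 1 ^ (2 * q)) ≤ commonMomentBound m K c b := by
  have h1 := Finset.single_le_sum (f := fun q => b q + 4 ^ q * (b (2 * q) + b 1 ^ (2 * q)))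
    (fun q _ => commonMomentBound_summand_nonneg hb0 q)
    (Finset.mem_range.2 (Nat.lt_succ_of_le hq))
  have h2 := envelopeBound_nonneg (K := K) hb0 (2 * m)
  have h3 : 0 ≤ (1 / c) ^ (2 * m) * envelopeBound b K (2 * m) := by positivity
  unfold commonMomentBound
  linarith

theorem one_add_le_commonMomentBound (hb0 : ∀ r, 0 ≤ b r) :
    1 + (1 / c) ^ (2 * m) * envelopeBound b K (2 * m) ≤ commonMomentBound m K c b :=
  le_add_of_nonneg_right (Finset.sum_nonneg fun q _ => commonMomentBound_summand_nonneg hb0 q)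

theorem commonMomentBound_nonneg (hc : 0 < c) (hb0 : ∀ r, 0 ≤ b r) :
    0 ≤ commonMomentBound m K c b :=
  (commonMomentBound_summand_nonneg hb0 0).trans (le_commonMomentBound hc hb0 (Nat.zero_le m))

theorem linearErrorConst_nonneg (hK : 0 < K) (hc : 0 < c) : 0 ≤ linearErrorConst m K c := by
  have := formLipschitz_nonneg hc K
  have := goodRadius_pos hK hc
  unfold linearErrorConst
  positivity

theorem tailErrorConst_nonneg (hK : 0 < K) (hc : 0 < c) : 0 ≤ tailErrorConst m K c := by
  have := goodRadius_pos hK hc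
  unfold tailErrorConst
  positivity

theorem plugInErrorConst_pos (hK : 0 < K) (hc : 0 < c) (hb0 : ∀ r, 0 ≤ b r) :
    0 < plugInErrorConst m K c b := by
  have h1 := linearErrorConst_nonneg (m := m) hK hc
  have h2 := tailErrorConst_nonneg (m := m) hK hc
  have h3 := commonMomentBound_nonneg (m := m) (K := K) hc hb0
  have h4 := evenMomentConst_nonneg h3 1
  have h5 := evenMomentConst_nonneg h3 m
  have h6 := envelopeBound_nonneg (K := K) hb0 (2 * m)
  unfold plugInErrorConst
  positivity

end Constants

variable {Ω : Type*} [MeasurableSpace Ω] {P : Measure Ω} [IsProbabilityMeasure P] {n : ℕ}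
  {ι : Type*} {m K : ℕ} {c : ℝ} {b : ℕ → ℝ}

/-- The entries of the first two centred moments of an observation. -/
def momentEntry (Sg : Matrix ι ι ℝ) (a : (ι × ι) ⊕ ι) (v : ι → ℝ) : ℝ :=
  Sum.elim (fun jk => v jk.1 * v jk.2 - Sg jk.1 jk.2) (fun j => v j) a

theorem measurable_momentEntry (Sg : Matrix ι ι ℝ) (a : (ι × ι) ⊕ ι) :
    Measurable (momentEntry Sg a) := by
  unfold momentEntry
  rcases a with ⟨j, k⟩ | j <;> simp only [Sum.elim_inl, Sum.elim_inr] <;> fun_prop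

variable [Fintype ι]

theorem momentDeviation_eq_sum (x : Fin n → ι → ℝ) (Sg : Matrix ι ι ℝ) :
    momentDeviation x Sg = ∑ a, ((n : ℝ)⁻¹ * ∑ i, momentEntry Sg a (x i)) ^ 2 := by
  rw [Fintype.sum_sum_type, Fintype.sum_prod_type]
  rfl

theorem integral_momentDeviation_pow_le (hn : 0 < n) (hK : Fintype.card ι ≤ K) (hc : 0 < c)
    {x : Fin n → Ω → ι → ℝ} {Sg : Matrix ι ι ℝ}
    (hL : ∀ i j, HasAllMoments (fun ω => x i ω j) P) (hind : iIndepFun x P)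
    (hmean : ∀ i j, ∫ ω, x i ω j ∂P = 0) (hcov : ∀ i j k, ∫ ω, x i ω j * x i ω k ∂P = Sg j k)
    (hb0 : ∀ r, 0 ≤ b r) (hb : ∀ i j r, ∫ ω, x i ω j ^ (2 * r) ∂P ≤ b r) {r : ℕ} (hr : 0 < r)
    (hrm : r ≤ m) :
    (∀ q : ℕ, HasAllMoments (fun ω => momentDeviation (fun i => x i ω) Sg ^ q) P) ∧
    ∫ ω, momentDeviation (fun i => x i ω) Sg ^ r ∂P ≤
      ((K ^ 2 + K : ℕ) : ℝ) ^ r * evenMomentConst (commonMomentBound m K c b) r / (n : ℝ) ^ r := by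
  have hcard : Fintype.card ((ι × ι) ⊕ ι) ≤ K ^ 2 + K := by
    rw [Fintype.card_sum, Fintype.card_prod, sq]
    gcongr
  have hXL : ∀ a i, HasAllMoments (fun ω => momentEntry Sg a (x i ω)) P := by
    rintro (⟨j, k⟩ | j) i
    · exact ((hL i j).mul (hL i k)).sub (HasAllMoments.const _)
    · exact hL i j
  simp_rw [momentDeviation_eq_sum]
  refine ⟨fun q => (HasAllMoments.sum _ fun a _ =>
    ((HasAllMoments.sum _ fun i _ => hXL a i).const_mul _).pow 2).pow q, ?_⟩
  refine integral_sum_sq_average_pow_le hcard hn hXL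
    (fun a => hind.comp (fun _ => momentEntry Sg a) fun _ => measurable_momentEntry Sg a)
    ?_ (commonMomentBound_nonneg hc hb0) hr ?_
  · rintro (⟨j, k⟩ | j) i
    · simp only [momentEntry, Sum.elim_inl]
      rw [integral_sub ((hL i j).mul (hL i k)).integrable (integrable_const _), hcov]
      simp
    · exact hmean i j
  · intro a i q hq
    have hle := le_commonMomentBound (K := K) hc hb0 (hq.trans hrm)
    have h1 := hb0 1
    have h2 := hb0 q
    have h3 := hb0 (2 * q)
    have h4 : 0 ≤ 4 ^ q * (b (2 * q) + b 1 ^ (2 * q)) := by positivity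
    rcases a with ⟨j, k⟩ | j
    · have h5 := integral_mul_sub_pow_even_le (hL i j) (hL i k) (hb i j) (hb i k) q
      simp only [momentEntry, Sum.elim_inl]
      rw [hcov] at h5
      linarith
    · have h5 := hb i j q
      simp only [momentEntry, Sum.elim_inr]
      linarith

/-- The square of an average is at most the average of the squares, so no independence is needed. -/
theorem integral_normEnvelope_sq_le (hn : 0 < n) (hm : 0 < m) (hK : Fintype.card ι ≤ K)
    {x : Fin n → Ω → ι → ℝ} (hL : ∀ i j, HasAllMoments (fun ω => x i ω j) P)
    (hb0 : ∀ r, 0 ≤ b r) (hb : ∀ i j r, ∫ ω, x i ω j ^ (2 * r) ∂P ≤ b r) :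
    HasAllMoments (fun ω => normEnvelope m fun i => x i ω) P ∧
    ∫ ω, normEnvelope m (fun i => x i ω) ^ 2 ∂P ≤ envelopeBound b K (2 * m) := by
  have hn' : (0 : ℝ) < n := by exact_mod_cast hn
  have hA : ∀ i q, HasAllMoments (fun ω => (1 + x i ω ⬝ᵥ x i ω) ^ q) P := fun i q =>
    ((HasAllMoments.const 1).add (HasAllMoments.sum _ fun j _ => (hL i j).mul (hL i j))).pow q
  have hE : HasAllMoments (fun ω => normEnvelope m fun i => x i ω) P :=
    (HasAllMoments.sum _ fun i _ => hA i m).const_mul _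
  have hS : HasAllMoments (fun ω => ∑ i, (1 + x i ω ⬝ᵥ x i ω) ^ (2 * m)) P :=
    HasAllMoments.sum _ fun i _ => hA i (2 * m)
  refine ⟨hE, ?_⟩
  calc _ ≤ ∫ ω, (n : ℝ)⁻¹ * ∑ i, (1 + x i ω ⬝ᵥ x i ω) ^ (2 * m) ∂P := by
        refine integral_mono (hE.pow 2).integrable (hS.const_mul _).integrable fun ω => ?_
        have h := sq_sum_le_card_mul_sum_sq (s := Finset.univ)
          (f := fun i => (1 + x i ω ⬝ᵥ x i ω) ^ m)
        simp only [Finset.card_univ, Fintype.card_fin, ← pow_mul, mul_comm m 2] at h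
        simp only [normEnvelope]
        calc _ = (n : ℝ)⁻¹ ^ 2 * (∑ i, (1 + x i ω ⬝ᵥ x i ω) ^ m) ^ 2 := mul_pow _ _ _
          _ ≤ (n : ℝ)⁻¹ ^ 2 * (n * ∑ i, (1 + x i ω ⬝ᵥ x i ω) ^ (2 * m)) := by gcongr
          _ = _ := by field_simp
    _ ≤ (n : ℝ)⁻¹ * ∑ _i : Fin n, envelopeBound b K (2 * m) := by
        rw [integral_const_mul, integral_finsetSum _ fun i _ => (hA i (2 * m)).integrable]
        gcongr with i
        exact integral_one_add_sum_sq_pow_le hK (hL i) (by omega) (hb0 _) fun j => hb i j _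
    _ = _ := by simp [hn'.ne']

variable [DecidableEq ι]

theorem measurable_inv_form_pow (Sg : Matrix ι ι ℝ) (m : ℕ) (τ : ℝ) :
    Measurable fun v : ι → ℝ => (v ⬝ᵥ (Sg⁻¹ *ᵥ v)) ^ m - τ := by
  unfold dotProduct Matrix.mulVec dotProduct
  fun_prop

theorem hasAllMoments_inv_form_pow {x : Ω → ι → ℝ} (hL : ∀ j, HasAllMoments (fun ω => x ω j) P)
    (Sg : Matrix ι ι ℝ) (m : ℕ) : HasAllMoments (fun ω => (x ω ⬝ᵥ (Sg⁻¹ *ᵥ x ω)) ^ m) P :=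
  (HasAllMoments.sum _ fun j _ => (hL j).mul
    (HasAllMoments.sum _ fun k _ => (hL k).const_mul _)).pow m

/-- The variance of the oracle average: the moment inequality with `r = 1`, where the centred second
moment is bounded by the raw one and then by the envelope. -/
theorem integral_average_inv_form_pow_sub_sq_le (hn : 0 < n) (hm : 0 < m)
    (hK : Fintype.card ι ≤ K) (hc : 0 < c)
    {x : Fin n → Ω → ι → ℝ} {Sg : Matrix ι ι ℝ}
    (hcoer : ∀ v, c * (v ⬝ᵥ v) ≤ v ⬝ᵥ (Sg *ᵥ v))
    (hL : ∀ i j, HasAllMoments (fun ω => x i ω j) P) (hind : iIndepFun x P)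
    (hb0 : ∀ r, 0 ≤ b r) (hb : ∀ i j r, ∫ ω, x i ω j ^ (2 * r) ∂P ≤ b r) {τ : ℝ}
    (hτ : ∀ i, ∫ ω, (x i ω ⬝ᵥ (Sg⁻¹ *ᵥ x i ω)) ^ m ∂P = τ) :
    ∫ ω, ((n : ℝ)⁻¹ * ∑ i, ((x i ω ⬝ᵥ (Sg⁻¹ *ᵥ x i ω)) ^ m - τ)) ^ 2 ∂P ≤
      evenMomentConst (commonMomentBound m K c b) 1 / n := by
  have hp := fun i => hasAllMoments_inv_form_pow (hL i) Sg m
  have hG : ∀ i, HasAllMoments (fun ω => (x i ω ⬝ᵥ (Sg⁻¹ *ᵥ x i ω)) ^ m - τ) P := fun i =>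
    (hp i).sub (HasAllMoments.const τ)
  have hle := one_add_le_commonMomentBound (m := m) (K := K) (c := c) hb0
  have he := envelopeBound_nonneg (K := K) hb0 (2 * m)
  have he' : 0 ≤ (1 / c) ^ (2 * m) * envelopeBound b K (2 * m) := by positivity
  have h := integral_average_pow_even_le hn hG
    (hind.comp (fun _ v => (v ⬝ᵥ (Sg⁻¹ *ᵥ v)) ^ m - τ) fun _ => measurable_inv_form_pow Sg m τ)
    (fun i => by rw [integral_sub (hp i).integrable (integrable_const _), hτ]; simp)
    (r := 1) (commonMomentBound_nonneg (m := m) (K := K) hc hb0) (fun i q hq => ?_)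
  · simpa using h
  · interval_cases q
    -- The moment of order zero is `1`; this is what the summand `1` in `commonMomentBound` is for.
    · simp only [mul_zero, pow_zero, integral_const, probReal_univ, smul_eq_mul, mul_one]
      linarith
    · have h1 : ∫ ω, ((x i ω ⬝ᵥ (Sg⁻¹ *ᵥ x i ω)) ^ m - τ) ^ 2 ∂P ≤
          ∫ ω, ((x i ω ⬝ᵥ (Sg⁻¹ *ᵥ x i ω)) ^ m) ^ 2 ∂P := by
        have h2 : ∀ ω, ((x i ω ⬝ᵥ (Sg⁻¹ *ᵥ x i ω)) ^ m - τ) ^ 2 =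
          ((x i ω ⬝ᵥ (Sg⁻¹ *ᵥ x i ω)) ^ m) ^ 2 - 2 * τ * (x i ω ⬝ᵥ (Sg⁻¹ *ᵥ x i ω)) ^ m + τ ^ 2 :=
          fun ω => by ring
        simp_rw [h2]
        rw [integral_add (((hp i).pow 2).sub ((hp i).const_mul _)).integrable
          (integrable_const _), integral_sub ((hp i).pow 2).integrable
          ((hp i).const_mul _).integrable, integral_const_mul, hτ]
        simp only [integral_const, probReal_univ, smul_eq_mul, one_mul]
        nlinarith [sq_nonneg τ]
      have h3 : ∫ ω, ((x i ω ⬝ᵥ (Sg⁻¹ *ᵥ x i ω)) ^ m) ^ 2 ∂P ≤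
          ∫ ω, (1 / c) ^ (2 * m) * (1 + x i ω ⬝ᵥ x i ω) ^ (2 * m) ∂P := by
        refine integral_mono ((hp i).pow 2).integrable ?_ fun ω => ?_
        · exact ((((HasAllMoments.const 1).add (HasAllMoments.sum _ fun j _ =>
            (hL i j).mul (hL i j))).pow (2 * m)).const_mul _).integrable
        · simp only
          rw [← pow_mul, mul_comm m 2]
          exact (inv_form_pow_le hc hcoer (2 * m) (x i ω)).2
      rw [integral_const_mul] at h3
      have h4 := integral_one_add_sum_sq_pow_le hK (hL i) (q := 2 * m) (by omega) (hb0 _)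
        (fun j => hb i j (2 * m))
      have h5 : (1 / c) ^ (2 * m) * ∫ ω, (1 + x i ω ⬝ᵥ x i ω) ^ (2 * m) ∂P ≤
        (1 / c) ^ (2 * m) * envelopeBound b K (2 * m) := by gcongr
      rw [mul_one]
      linarith

/-- The plug-in error of one block has an integrable majorant with mean of order `n^{-1/2}`. -/
theorem exists_plugIn_error_majorant (hn : 0 < n) (hm : 0 < m) (hK0 : 0 < K)
    (hK : Fintype.card ι ≤ K) (hc : 0 < c) {x : Fin n → Ω → ι → ℝ} {Sg : Matrix ι ι ℝ}
    (hsymm : Sg.IsSymm) (hcoer : ∀ v, c * (v ⬝ᵥ v) ≤ v ⬝ᵥ (Sg *ᵥ v))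
    (hL : ∀ i j, HasAllMoments (fun ω => x i ω j) P) (hind : iIndepFun x P)
    (hmean : ∀ i j, ∫ ω, x i ω j ∂P = 0) (hcov : ∀ i j k, ∫ ω, x i ω j * x i ω k ∂P = Sg j k)
    (hb0 : ∀ r, 0 ≤ b r) (hb : ∀ i j r, ∫ ω, x i ω j ^ (2 * r) ∂P ≤ b r) {τ : ℝ}
    (hτ : ∀ i, ∫ ω, (x i ω ⬝ᵥ (Sg⁻¹ *ᵥ x i ω)) ^ m ∂P = τ) :
    ∃ W : Ω → ℝ, Integrable W P ∧ ∫ ω, W ω ∂P ≤ plugInErrorConst m K c b * (√n)⁻¹ ∧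
      ∀ ω, |(n : ℝ)⁻¹ * ∑ i, ((x i ω - average fun i => x i ω) ⬝ᵥ
        ((columnCov fun i => x i ω)⁻¹ *ᵥ (x i ω - average fun i => x i ω))) ^ m - τ| ≤ W ω := by
  have hn' : (0 : ℝ) < n := by exact_mod_cast hn
  have hn1 : (1 : ℝ) ≤ n := by exact_mod_cast hn
  have hs : 0 < √(n : ℝ) := Real.sqrt_pos.2 hn'
  have hss : √(n : ℝ) * √n = n := Real.mul_self_sqrt hn'.le
  have hs1 : 1 ≤ √(n : ℝ) := Real.one_le_sqrt.2 hn1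
  -- Young's inequality with weight `√n` balances `E u² = O(1/n)` against `E v² = O(1)`, so both
  -- halves are of order `n^{-1/2}`.
  have hyoung : ∀ u v : ℝ, u * v ≤ (√n * u ^ 2 + (√n)⁻¹ * v ^ 2) / 2 := fun u v => by
    have h1 : 0 ≤ (√n)⁻¹ * (√n * u - v) ^ 2 := by positivity
    have h2 : (√n)⁻¹ * (√n * u - v) ^ 2 = √n * u ^ 2 + (√n)⁻¹ * v ^ 2 - 2 * (u * v) := by
      field_simp
      ring
    linarith
  have hC1 := linearErrorConst_nonneg (m := m) hK0 hc
  have hC2 := tailErrorConst_nonneg (m := m) hK0 hc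
  have hG : HasAllMoments (fun ω => (n : ℝ)⁻¹ * ∑ i, ((x i ω ⬝ᵥ (Sg⁻¹ *ᵥ x i ω)) ^ m - τ)) P :=
    (HasAllMoments.sum _ fun i _ => (hasAllMoments_inv_form_pow (hL i) Sg m).sub
      (HasAllMoments.const τ)).const_mul _
  have hG2 := integral_average_inv_form_pow_sub_sq_le hn hm hK hc hcoer hL hind hb0 hb hτ
  obtain ⟨hH, hH2⟩ := integral_normEnvelope_sq_le hn hm hK hL hb0 hb
  obtain ⟨hR, hR1⟩ := integral_momentDeviation_pow_le hn hK hc hL hind hmean hcov hb0 hb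
    (r := 1) (m := m) one_pos hm
  obtain ⟨-, hRm⟩ := integral_momentDeviation_pow_le hn hK hc hL hind hmean hcov hb0 hb
    (r := m) (m := m) hm le_rfl
  have hR' : HasAllMoments (fun ω => momentDeviation (fun i => x i ω) Sg) P := by
    simpa using hR 1
  simp only [pow_one] at hR1
  set G := fun ω => (n : ℝ)⁻¹ * ∑ i, ((x i ω ⬝ᵥ (Sg⁻¹ *ᵥ x i ω)) ^ m - τ) with hGdef
  set H := fun ω => normEnvelope m (fun i => x i ω) with hHdef
  set R := fun ω => momentDeviation (fun i => x i ω) Sg with hRdef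
  have hI1 : HasAllMoments (fun ω => (√n * G ω ^ 2 + (√n)⁻¹ * 1 ^ 2) / 2) P := by
    simp_rw [div_eq_inv_mul]
    exact (((hG.pow 2).const_mul _).add (HasAllMoments.const _)).const_mul _
  have hI2 : HasAllMoments (fun ω => linearErrorConst m K c *
      ((√n * R ω + (√n)⁻¹ * H ω ^ 2) / 2)) P := by
    simp_rw [div_eq_inv_mul]
    exact (((hR'.const_mul _).add ((hH.pow 2).const_mul _)).const_mul _).const_mul _
  have hI3 : HasAllMoments (fun ω => tailErrorConst m K c * ((n : ℝ) ^ (m - 1) * R ω ^ m)) P :=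
    ((hR m).const_mul _).const_mul _
  -- The summands dominate the oracle error `|G| · 1`, the linear error `√R · H` and the
  -- contribution of ill-conditioned samples. The majorant is polynomial in the data, so its
  -- integrability is immediate, unlike that of the estimator.
  refine ⟨fun ω => (√n * G ω ^ 2 + (√n)⁻¹ * 1 ^ 2) / 2 +
    linearErrorConst m K c * ((√n * R ω + (√n)⁻¹ * H ω ^ 2) / 2) +
    tailErrorConst m K c * ((n : ℝ) ^ (m - 1) * R ω ^ m),
    ((hI1.add hI2).add hI3).integrable, ?_, fun ω => ?_⟩
  · rw [integral_add (hI1.add hI2).integrable hI3.integrable,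
      integral_add hI1.integrable hI2.integrable, integral_div,
      integral_add ((hG.pow 2).const_mul _).integrable (integrable_const _), integral_const_mul,
      integral_const_mul, integral_const_mul, integral_div, integral_add (hR'.const_mul _).integrable
      ((hH.pow 2).const_mul _).integrable, integral_const_mul, integral_const_mul,
      integral_const_mul, integral_const_mul]
    simp only [integral_const, probReal_univ, smul_eq_mul, one_pow, mul_one]
    have hdiv : ∀ e : ℝ, √n * (e / n) = e * (√n)⁻¹ := fun e => by
      have h : √n * (e / n) * √n = e * ((√n * √n) / n) := by ring
      rw [eq_mul_inv_iff_mul_eq₀ hs.ne', h, hss, div_self hn'.ne', mul_one]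
    set E1 := evenMomentConst (commonMomentBound m K c b) 1
    set Em := evenMomentConst (commonMomentBound m K c b) m
    have hEm : 0 ≤ Em := evenMomentConst_nonneg (commonMomentBound_nonneg hc hb0) m
    have b1 : √n * ∫ ω, G ω ^ 2 ∂P ≤ E1 * (√n)⁻¹ := by
      rw [← hdiv]
      gcongr
    have b2 : √n * ∫ ω, R ω ∂P ≤ ((K ^ 2 + K : ℕ) : ℝ) ^ 1 * E1 * (√n)⁻¹ := by
      rw [← hdiv]
      rw [pow_one]
      gcongr
    have b3 : (√n)⁻¹ * ∫ ω, H ω ^ 2 ∂P ≤ envelopeBound b K (2 * m) * (√n)⁻¹ := by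
      rw [mul_comm]
      gcongr
    -- The deterministic growth `n^{m-1}` meets `E R^m = O(n^{-m})`, which leaves `1/n`.
    have b4 : (n : ℝ) ^ (m - 1) * ∫ ω, R ω ^ m ∂P ≤ ((K ^ 2 + K : ℕ) : ℝ) ^ m * Em * (√n)⁻¹ := by
      calc _ ≤ (n : ℝ) ^ (m - 1) * (((K ^ 2 + K : ℕ) : ℝ) ^ m * Em / (n : ℝ) ^ m) := by gcongr
        _ = ((K ^ 2 + K : ℕ) : ℝ) ^ m * Em * (n : ℝ)⁻¹ := by
          obtain ⟨k, rfl⟩ : ∃ k, m = k + 1 := ⟨m - 1, by omega⟩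
          rw [Nat.add_sub_cancel, pow_succ (n : ℝ) k]
          field_simp
        _ ≤ _ := by
          gcongr
          nlinarith
    have b5 := mul_le_mul_of_nonneg_left (add_le_add b2 b3) hC1
    have b6 := mul_le_mul_of_nonneg_left b4 hC2
    unfold plugInErrorConst
    linarith
  · have h1 := abs_plugIn_sub_le hn (fun i => x i ω) hm hK0 hK hc hsymm hcoer
    have h2 : (n : ℝ)⁻¹ * ∑ i, (x i ω ⬝ᵥ (Sg⁻¹ *ᵥ x i ω)) ^ m - τ = G ω := by
      simp only [hGdef, Finset.sum_sub_distrib, Finset.sum_const, Finset.card_univ,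
        Fintype.card_fin, nsmul_eq_mul, mul_sub]
      rw [inv_mul_cancel_left₀ hn'.ne']
    have h3 := hyoung |G ω| 1
    rw [mul_one, sq_abs] at h3
    have h4 := hyoung √(R ω) (H ω)
    rw [Real.sq_sqrt (momentDeviation_nonneg _ _)] at h4
    have h5 := mul_le_mul_of_nonneg_left h4 hC1
    refine (abs_sub_le _ ((n : ℝ)⁻¹ * ∑ i, (x i ω ⬝ᵥ (Sg⁻¹ *ᵥ x i ω)) ^ m) _).trans ?_
    rw [h2]
    simp only [hRdef, hHdef] at h1 h5 ⊢
    linarith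

end PlugInError

/-! ### From one block to the aggregated estimator -/

section Assembly

variable {Ω : Type*} [MeasurableSpace Ω] {P : Measure Ω} {n p : ℕ}

theorem psiNorm_comp {X : Type*} [MeasurableSpace X] {law : Measure X} {Y : Ω → X}
    (hY : HasLaw Y law P) {f : X → ℝ} (hf : Measurable f) :
    psiNorm (fun ω => f (Y ω)) P = psiNorm f law := by
  unfold psiNorm
  refine iSup_congr fun k => iSup_congr fun _ => ?_
  rw [← hY.map_eq, eLpNorm_map_measure hf.aestronglyMeasurable hY.aemeasurable]
  rfl

variable [IsProbabilityMeasure P]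

/-- Sample mean and sample covariance absorb a translation, so the data may be centred at the
unknown `mu`. -/
theorem blockEstimator_eq (hn : 0 < n) (m : ℕ) (J : Finset (Fin p))
    (mu : EuclideanSpace ℝ (Fin p)) (y : Fin n → EuclideanSpace ℝ (Fin p)) :
    blockEstimator m J (sampleMean y) (sampleCov y) y =
      ((n : ℝ)⁻¹ * ∑ i, (((fun j : J => y i j - mu j) - average fun i (j : J) => y i j - mu j) ⬝ᵥ
        ((columnCov fun i (j : J) => y i j - mu j)⁻¹ *ᵥ
          ((fun j : J => y i j - mu j) - average fun i (j : J) => y i j - mu j))) ^ m) /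
        cStar p m J.card := by
  have hn' : (n : ℝ) ≠ 0 := by exact_mod_cast hn.ne'
  have hmean : ∀ j, sampleMean y j = (n : ℝ)⁻¹ * ∑ i, y i j := fun j => by
    simp [sampleMean]
  have hshift : ∀ (i : Fin n) (j : J), (y i j - mu j) - average (fun i (j : J) => y i j - mu j) j =
      y i j - sampleMean y j := fun i j => by
    simp only [average, hmean, Finset.sum_sub_distrib, Finset.sum_const, Finset.card_univ,
      Fintype.card_fin, nsmul_eq_mul, mul_sub]
    rw [inv_mul_cancel_left₀ hn']
    ring
  have hcov : diagBlock (sampleCov y) J = columnCov fun i (j : J) => y i j - mu j := by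
    ext j k
    simp only [diagBlock, sampleCov, columnCov, Matrix.submatrix_apply, Matrix.of_apply, hshift]
  have hvec : ∀ i, (fun j : J => (y i - sampleMean y) j) =
      (fun j : J => y i j - mu j) - average fun i (j : J) => y i j - mu j := fun i => by
    ext j
    rw [Pi.sub_apply, hshift]
    rfl
  unfold blockEstimator blockForm
  simp_rw [hvec, hcov]
  rw [inv_mul_eq_div, div_div]

/-- Bounds on even moments that follow from the bound `C` on the `ψ`-norm. -/
noncomputable def psiMomentBound (C : ℝ) (r : ℕ) : ℝ := (2 * r * max C 0) ^ (2 * r)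

theorem psiMomentBound_nonneg (C : ℝ) (r : ℕ) : 0 ≤ psiMomentBound C r := by
  unfold psiMomentBound; positivity

theorem exists_blockEstimator_error_majorant (hn : 0 < n) {m K : ℕ} (hm : 0 < m) (hK0 : 0 < K)
    (hKp : K ≤ p) {C c : ℝ} (hc : 0 < c) {mu : EuclideanSpace ℝ (Fin p)}
    {Sig : Matrix (Fin p) (Fin p) ℝ} {nu : Measure ℝ} (hSig : Sig.PosSemidef)
    (hnu : IsRadialLaw p nu)
    (hpsi : ∀ j : Fin p, psiNorm (fun y : EuclideanSpace ℝ (Fin p) => y j - mu j)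
      (ellipticalLaw mu Sig nu) ≤ ENNReal.ofReal C)
    (heig : ∀ J : Finset (Fin p), J.card = K → ∀ l ∈ spectrum ℝ (diagBlock Sig J), c ≤ l)
    {J : Finset (Fin p)} (hJ : J.Nonempty) (hJK : J.card ≤ K)
    {Y : Fin n → Ω → EuclideanSpace ℝ (Fin p)}
    (hY : ∀ i, HasLaw (Y i) (ellipticalLaw mu Sig nu) P) (hind : iIndepFun Y P) :
    ∃ W : Ω → ℝ, Integrable W P ∧
      ∫ ω, W ω ∂P ≤ plugInErrorConst m K c (psiMomentBound C) * (√n)⁻¹ ∧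
      ∀ ω, |blockEstimator m J (sampleMean fun i => Y i ω) (sampleCov fun i => Y i ω)
        (fun i => Y i ω) - scaledMoment p m nu| ≤ W ω := by
  have hp : 0 < p := hK0.trans_le hKp
  have hcoer : ∀ v : J → ℝ, c * (v ⬝ᵥ v) ≤ v ⬝ᵥ (diagBlock Sig J *ᵥ v) :=
    le_dotProduct_diagBlock_mulVec hSig hKp heig hJK
  have hherm : (diagBlock Sig J).IsHermitian :=
    (hSig.submatrix (Subtype.val : J → Fin p)).isHermitian
  have hpos : (diagBlock Sig J).PosDef := by
    refine Matrix.PosDef.of_dotProduct_mulVec_pos hherm fun v hv => ?_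
    have h0 : 0 < v ⬝ᵥ v := (dotProduct_self_nonneg_real v).lt_of_ne'
      fun h => hv (dotProduct_self_eq_zero.1 h)
    rw [star_trivial]
    exact (mul_pos hc h0).trans_le (hcoer v)
  have hmeas : ∀ j : Fin p, Measurable fun y : EuclideanSpace ℝ (Fin p) => y j - mu j :=
    fun j => by fun_prop
  have hae : ∀ i (j : Fin p), AEMeasurable (fun ω => Y i ω j - mu j) P := fun i j =>
    (hmeas j).comp_aemeasurable (hY i).aemeasurable
  have hpsi' : ∀ i (j : Fin p), psiNorm (fun ω => Y i ω j - mu j) P ≤ ENNReal.ofReal C :=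
    fun i j => (psiNorm_comp (hY i) (hmeas j)).trans_le (hpsi j)
  have hτ : ∀ i, ∫ ω, ((fun j : J => Y i ω j - mu j) ⬝ᵥ ((diagBlock Sig J)⁻¹ *ᵥ
      fun j : J => Y i ω j - mu j)) ^ m ∂P = cStar p m J.card * scaledMoment p m nu := fun i => by
    rw [← integral_blockForm_pow_ellipticalLaw mu hSig hnu hJ hpos,
      ← (hY i).integral_comp (f := fun y => blockForm (y - mu) Sig J ^ m)
        (Continuous.aestronglyMeasurable
        (((continuous_blockForm Sig J).comp (continuous_id.sub continuous_const)).pow m))]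
    rfl
  obtain ⟨W, hW, hWint, hle⟩ := exists_plugIn_error_majorant (P := P) hn hm hK0
    (by simpa using hJK) hc (x := fun i ω (j : J) => Y i ω j - mu j) (Sg := diagBlock Sig J)
    (by simpa using hherm)
    hcoer (fun i j => hasAllMoments_of_psiNorm_le (hae i j) (hpsi' i j))
    (hind.comp (fun _ y (j : J) => y j - mu j) fun _ => by fun_prop)
    (fun i j => by
      rw [← integral_coordinate_ellipticalLaw (Sig := Sig) hp mu hnu j,
        ← (hY i).integral_comp (hmeas j).aestronglyMeasurable]
      rfl)
    (fun i j k => by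
      refine Eq.trans ?_ (integral_coordinate_mul_coordinate_ellipticalLaw hp mu hSig hnu j k)
      rw [← (hY i).integral_comp (f := fun y => (y j - mu j) * (y k - mu k))
        ((hmeas j).mul (hmeas k)).aestronglyMeasurable]
      rfl)
    (b := psiMomentBound C) (psiMomentBound_nonneg C)
    (fun i j r => integral_pow_even_le_of_psiNorm_le (hae i j) (hpsi' i j) r) hτ
  refine ⟨W, hW, hWint, fun ω => le_trans ?_ (hle ω)⟩
  have hcs : 1 ≤ cStar p m J.card := one_le_cStar m hJ.card_pos (hJK.trans hKp)
  have hcs0 : 0 < cStar p m J.card := one_pos.trans_le hcs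
  -- The majorant controls the error before division by `c*`, and `c* ≥ 1`.
  rw [blockEstimator_eq hn m J mu, div_sub' hcs0.ne', abs_div, abs_of_pos hcs0]
  exact div_le_self (abs_nonneg _) hcs

theorem abs_bae_sub_le {m : ℕ} {A : Finset (Finset (Fin p))} (hA : A.Nonempty)
    {mu : EuclideanSpace ℝ (Fin p)} {S : Matrix (Fin p) (Fin p) ℝ}
    {y : Fin n → EuclideanSpace ℝ (Fin p)} {θ : ℝ} {w : Finset (Fin p) → ℝ}
    (h : ∀ J ∈ A, |blockEstimator m J mu S y - θ| ≤ w J) :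
    |bae m A mu S y - θ| ≤ (A.card : ℝ)⁻¹ * ∑ J ∈ A, w J := by
  have hcard : (0 : ℝ) < A.card := by exact_mod_cast hA.card_pos
  have h1 : bae m A mu S y - θ =
      (A.card : ℝ)⁻¹ * ∑ J ∈ A, (blockEstimator m J mu S y - θ) := by
    rw [bae, Finset.sum_sub_distrib, Finset.sum_const, nsmul_eq_mul]
    field_simp
  rw [h1, abs_mul, abs_of_pos (inv_pos.2 hcard)]
  gcongr
  exact (Finset.abs_sum_le_sum_abs _ _).trans (Finset.sum_le_sum h)

/-- Markov's inequality for `W`; `X` need not be measurable. -/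
theorem measure_lt_abs_le_of_majorant {X W : Ω → ℝ} (hW : Integrable W P)
    (hXW : ∀ ω, |X ω| ≤ W ω) {D a ε : ℝ} (hint : ∫ ω, W ω ∂P ≤ D * a) (ha : 0 < a) (hD : 0 < D)
    (hε : 0 < ε) : P {ω | D / ε * a < |X ω|} ≤ ENNReal.ofReal ε := by
  have hsub : P {ω | D / ε * a < |X ω|} ≤ P {ω | D / ε * a ≤ W ω} :=
    measure_mono fun ω (hω : D / ε * a < |X ω|) => hω.le.trans (hXW ω)
  refine hsub.trans ?_
  rw [← ofReal_measureReal]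
  refine ENNReal.ofReal_le_ofReal ?_
  have h := mul_meas_ge_le_integral_of_nonneg
    (ae_of_all _ fun ω => (abs_nonneg _).trans (hXW ω)) hW (D / ε * a)
  have hpos : 0 < D / ε * a := by positivity
  refine le_of_mul_le_mul_left (h.trans (hint.trans (le_of_eq ?_))) hpos
  field_simp

end Assembly

end EllipticalMoment

theorem theorem5
    -- fixed: the order of the moment, the bound on the block size, the constants
    (m K : ℕ) (hm : 2 ≤ m) (hK : 1 ≤ K) (C c : ℝ) (hc : 0 < c)
    -- sample size and dimension along the sequence of problems
    (n p : ℕ → ℕ) (hn : Tendsto n atTop atTop) (hp : ∀ᶠ t in atTop, K ≤ p t)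
    (hlog : (fun t => Real.log (p t) ^ (2 * m)) =o[atTop] (fun t => (n t : ℝ)))
    -- parameters of the elliptical model
    (mu : ∀ t, EuclideanSpace ℝ (Fin (p t))) (Sig : ∀ t, Matrix (Fin (p t)) (Fin (p t)) ℝ)
    (nu : ∀ t, Measure ℝ)
    (hSig : ∀ t, (Sig t).PosSemidef) (hnu : ∀ t, EllipticalMoment.IsRadialLaw (p t) (nu t))
    -- marginal tails
    (hpsi : ∀ t, ∀ j : Fin (p t),
      EllipticalMoment.psiNorm (fun y : EuclideanSpace ℝ (Fin (p t)) => y j - mu t j)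
        (EllipticalMoment.ellipticalLaw (mu t) (Sig t) (nu t)) ≤ ENNReal.ofReal C)
    -- the smallest eigenvalue of every `K × K` diagonal block is at least `c`
    (heig : ∀ t, ∀ J : Finset (Fin (p t)), J.card = K →
      ∀ l ∈ spectrum ℝ (EllipticalMoment.diagBlock (Sig t) J), c ≤ l)
    -- a non-empty collection of non-overlapping blocks of size at most `K`
    (A : ∀ t, Finset (Finset (Fin (p t)))) (hA : ∀ t, (A t).Nonempty)
    (hA_ne : ∀ t, ∀ J ∈ A t, J.Nonempty) (hA_card : ∀ t, ∀ J ∈ A t, J.card ≤ K)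
    (hA_disj : ∀ t, ∀ I ∈ A t, ∀ J ∈ A t, I ≠ J → Disjoint I J)
    -- i.i.d. samples
    {Ω : ℕ → Type*} [∀ t, MeasurableSpace (Ω t)] (P : ∀ t, Measure (Ω t))
    [∀ t, IsProbabilityMeasure (P t)]
    (Y : ∀ t, Fin (n t) → Ω t → EuclideanSpace ℝ (Fin (p t)))
    (hY_law : ∀ t i,
      HasLaw (Y t i) (EllipticalMoment.ellipticalLaw (mu t) (Sig t) (nu t)) (P t))
    (hY_indep : ∀ t, iIndepFun (Y t) (P t)) :
    EllipticalMoment.IsBigOInProb P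
      (fun t ω =>
        EllipticalMoment.bae m (A t) (EllipticalMoment.sampleMean fun i => Y t i ω)
            (EllipticalMoment.sampleCov fun i => Y t i ω) (fun i => Y t i ω)
          - EllipticalMoment.scaledMoment (p t) m (nu t))
      (fun t => (n t : ℝ) ^ (-(1 / 2 : ℝ))) := by
  intro ε hε
  set b := EllipticalMoment.psiMomentBound C
  set D := EllipticalMoment.plugInErrorConst m K c b
  have hD : 0 < D :=
    EllipticalMoment.plugInErrorConst_pos hK hc (EllipticalMoment.psiMomentBound_nonneg C)
  -- The threshold from Markov's inequality; `D` does not depend on `t`, which gives uniformity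
  -- along the sequence.
  refine ⟨D / ε, by positivity, ?_⟩
  filter_upwards [hp, hn.eventually_gt_atTop 0] with t hpt hnt
  have hnt' : (0 : ℝ) < n t := by exact_mod_cast hnt
  have hex := fun J hJ => EllipticalMoment.exists_blockEstimator_error_majorant (P := P t) hnt
    (m := m) (by omega) hK hpt hc (hSig t) (hnu t) (hpsi t) (heig t) (hA_ne t J hJ)
    (hA_card t J hJ) (hY_law t) (hY_indep t)
  choose! W hW hWint hWle using hex
  have hcard : (0 : ℝ) < (A t).card := by exact_mod_cast (hA t).card_pos
  refine EllipticalMoment.measure_lt_abs_le_of_majorant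
    (W := fun ω => ((A t).card : ℝ)⁻¹ * ∑ J ∈ A t, W J ω)
    ((integrable_finsetSum _ hW).const_mul _)
    (fun ω => EllipticalMoment.abs_bae_sub_le (hA t) fun J hJ => hWle J hJ ω)
    ?_ (Real.rpow_pos_of_pos hnt' _) hD hε
  rw [integral_const_mul, integral_finsetSum _ hW, Real.rpow_neg hnt'.le, ← Real.sqrt_eq_rpow]
  -- All blocks share the constant `D`, so averaging over them leaves the bound unchanged.
  calc _ ≤ ((A t).card : ℝ)⁻¹ * ∑ _J ∈ A t, D * (√(n t : ℝ))⁻¹ := by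
        gcongr with J hJ
        exact hWint J hJ
    _ = _ := by
        rw [Finset.sum_const, nsmul_eq_mul, inv_mul_cancel_left₀ hcard.ne']
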